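/- Let $\mathcal X,\mathcal Y$ be real Hilbert spaces, $f:\mathcal X\to\mathbb R$ convex and continuously differentiable, $A:\mathcal X\to\mathcal Y$ a bounded linear operator and $b\in\mathcal Y$. Put $\mathcal L(x,\lambda)=f(x)+\langle\lambda,Ax-b\rangle$ and let $\Omega\subset\mathcal X\times\mathcal Y$ be its set of saddle points, i.e. of pairs $(\bar x,\bar\lambda)$ with $\mathcal L(\bar x,\lambda)\le\mathcal L(\bar x,\bar\lambda)\le\mathcal L(x,\bar\lambda)$ for all $(x,\lambda)$; assume $\Omega\neq\emptyset$. The product $\mathcal X\times\mathcal Y$ carries the norm $\|(x,\lambda)\|^2=\|x\|^2+\|\lambda\|^2$. Let $\alpha>1$, $\gamma>0$, $c>0$, $s>0$, $0<q<1$, $t_0>0$, and let $p$ satisfy $0<p<1-q$, $4q+s+p-2<0$ and $3q+s-p-1<0$. For $t\ge t_0$ put $$\mathcal L_t(x,\lambda)=\mathcal L(x,\lambda)+\frac{c}{2t^p}\left(\|x\|^2-\|\lambda\|^2\right).$$ Let $m:[t_0,+\infty)\to(0,+\infty)$ be differentiable and non-increasing, and suppose that there are $k_1,k_2>0$ such that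 for all sufficiently large $t$: $m$ is twice differentiable at $t$, $$\frac{\gamma}{t^{q+s}}\le m(t)\le\frac{k_1}{t^q},\qquad t|\dot m(t)|\le k_2m(t),\qquad t^2|\ddot m(t)|\le k_2m(t).$$ Let $$\theta(t)=\frac{m(t)t^{2q+s}+\gamma t^q-2m(t)\gamma q t^{2q-1}-\gamma\dot m(t)t^{2q}}{(\alpha-1)(t^{q+s}-\gamma q t^{q-1})},$$ and let $(x,\lambda):[t_0,+\infty)\to\mathcal X\times\mathcal Y$ be a global solution of $$\left\{\begin{aligned}&m(t)\ddot x(t)+\frac{\alpha}{t^q}\dot x(t)+\gamma\frac{d}{dt}\nabla_x\mathcal L_t(x(t),\lambda(t))+t^s\nabla_x\mathcal L_t(x(t),\lambda(t))=0,\\&\dot\lambda(t)-(\alpha-1)(t^{q+s}-\gamma q t^{q-1})\nabla_\lambda\mathcal L_t\big(x(t)+\theta(t)\dot x(t),\lambda(t)\big)=0,\end{aligned}\right.$$ that is, $x$ is twice differentiable, $\lambda$ and $t\mapsto\nabla_x\mathcal L_t(x(t),\lambda(t))$ are differentiable, and both equations hold for every $t\ge t_0$ (with one-sided derivatives at $t_0$).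 Then $\Omega$ has a unique element of minimal norm $(x^*,\lambda^*)=\mathrm{Proj}_\Omega 0$, for every $t\ge t_0$ the function $\mathcal L_t$ has a unique saddle point $(x_t,\lambda_t)$, and, with $r=\max\{q,p-q-s\}$: (i) $\lim_{t\to+\infty}\|(x(t),\lambda(t))-(x^*,\lambda^*)\|=0$. (ii) If $\frac{1-q}{2}\le p<1-q$, then as $t\to+\infty$ each of $\mathcal L(x(t),\lambda^*)-\mathcal L(x^*,\lambda^*)$, $|f(x(t))-f(x^*)|$ and $\|Ax(t)-b\|$ is $\mathcal O\left(\sqrt{m(t)}\,t^{\frac{3q+s+p-2+r}{2}}+\frac1{t^p}\right)$, and $\|(x(t)-x_t,\lambda(t)-\lambda_t)\|^2=\mathcal O\left(m(t)\,t^{3q+s+p-2+r}\right)$. (iii) If $0<p<\frac{1-q}{2}$, then as $t\to+\infty$ each of $\mathcal L(x(t),\lambda^*)-\mathcal L(x^*,\lambda^*)$, $|f(x(t))-f(x^*)|$ and $\|Ax(t)-b\|$ is $\mathcal O\left(\sqrt{m(t)}\,t^{\frac{2q+s-p-1+r}{2}}+\frac1{t^p}\right)$, and $\|(x(t)-x_t,\lambda(t)-\lambda_t)\|^2=\mathcal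 O\left(m(t)\,t^{2q+s-p-1+r}\right)$. -/

import Mathlib

open Set Filter Topology Asymptotics

noncomputable section

section Lagrangians

variable {X Y : Type*} [NormedAddCommGroup X] [InnerProductSpace ℝ X]
  [NormedAddCommGroup Y] [InnerProductSpace ℝ Y]

/-- The Lagrangian `L(x, l) = f x + ⟨l, A x - b⟩` of the problem `min f x` subject to `A x = b`. -/
def lagrangian (f : X → ℝ) (A : X →L[ℝ] Y) (b : Y) (x : X) (l : Y) : ℝ :=
  f x + inner ℝ l (A x - b)

/-- The Tikhonov regularized Lagrangian
`L_t(x, l) = L(x, l) + c / (2 t ^ p) * (‖x‖ ^ 2 - ‖l‖ ^ 2)`. -/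
def regLagrangian (f : X → ℝ) (A : X →L[ℝ] Y) (b : Y) (c p t : ℝ) (x : X) (l : Y) : ℝ :=
  lagrangian f A b x l + c / (2 * t ^ p) * (‖x‖ ^ 2 - ‖l‖ ^ 2)

/-- `z = (x, l)` is a saddle point of `L`: `L(x, l') ≤ L(x, l) ≤ L(x', l)` for all `x'`, `l'`.
Pairs live in the Hilbert product, with norm `‖(x, l)‖ ^ 2 = ‖x‖ ^ 2 + ‖l‖ ^ 2`. -/
def IsSaddlePt (L : X → Y → ℝ) (z : WithLp 2 (X × Y)) : Prop :=
  ∀ (x' : X) (l' : Y), L z.fst l' ≤ L z.fst z.snd ∧ L z.fst z.snd ≤ L x' z.snd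

/-- The set of saddle points of the Lagrangian (the primal-dual solutions). -/
def primalDualSolutions (f : X → ℝ) (A : X →L[ℝ] Y) (b : Y) : Set (WithLp 2 (X × Y)) :=
  {z | IsSaddlePt (lagrangian f A b) z}

/-- `z` is a metric projection of `u` onto the set `S`. -/
def IsProjOnto {E : Type*} [NormedAddCommGroup E] (S : Set E) (u z : E) : Prop :=
  z ∈ S ∧ ∀ w ∈ S, ‖u - z‖ ≤ ‖u - w‖

end Lagrangians

/-- The standing conditions on the mass `m : [t₀, ∞) → (0, ∞)`: positive, differentiable and
monotonically non-increasing. -/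
structure IsMass (t₀ : ℝ) (m : ℝ → ℝ) : Prop where
  pos : ∀ t ∈ Ici t₀, 0 < m t
  diff : DifferentiableOn ℝ m (Ici t₀)
  anti : AntitoneOn m (Ici t₀)

/-- There is `k₁ > 0` with `γ / t ^ (q + s) ≤ m t ≤ k₁ / t ^ q` for `t` large. -/
def MassBounds (γ q s : ℝ) (m : ℝ → ℝ) : Prop :=
  ∃ k₁ > 0, ∀ᶠ t : ℝ in atTop, γ / t ^ (q + s) ≤ m t ∧ m t ≤ k₁ / t ^ q

/-- There is `k₂ > 0` such that, for `t` large, `m` is twice differentiable at `t`,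
`t |m'(t)| ≤ k₂ m(t)` and `t ^ 2 |m''(t)| ≤ k₂ m(t)`. -/
def MassDerivBounds (t₀ : ℝ) (m : ℝ → ℝ) : Prop :=
  ∃ k₂ > 0, ∀ᶠ t : ℝ in atTop,
    DifferentiableWithinAt ℝ (derivWithin m (Ici t₀)) (Ici t₀) t ∧
    t * |derivWithin m (Ici t₀) t| ≤ k₂ * m t ∧
    t ^ 2 * |derivWithin (derivWithin m (Ici t₀)) (Ici t₀) t| ≤ k₂ * m t

/-- The extrapolation parameter `θ(t)`. -/
def extrapolation (α γ q s t₀ : ℝ) (m : ℝ → ℝ) (t : ℝ) : ℝ :=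
  (m t * t ^ (2 * q + s) + γ * t ^ q - 2 * m t * γ * q * t ^ (2 * q - 1)
      - γ * derivWithin m (Ici t₀) t * t ^ (2 * q))
    / ((α - 1) * (t ^ (q + s) - γ * q * t ^ (q - 1)))

section System

variable {X Y : Type*} [NormedAddCommGroup X] [InnerProductSpace ℝ X] [CompleteSpace X]
  [NormedAddCommGroup Y] [InnerProductSpace ℝ Y] [CompleteSpace Y]

/-- The partial gradient of `L_t` in the primal variable. -/
def gradPrimal (f : X → ℝ) (A : X →L[ℝ] Y) (b : Y) (c p t : ℝ) (x : X) (l : Y) : X :=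
  gradient (fun x' => regLagrangian f A b c p t x' l) x

/-- The partial gradient of `L_t` in the dual variable. -/
def gradDual (f : X → ℝ) (A : X →L[ℝ] Y) (b : Y) (c p t : ℝ) (x : X) (l : Y) : Y :=
  gradient (fun l' => regLagrangian f A b c p t x l') l

/-- `(x, l) : [t₀, ∞) → X × Y` is a global (classical) solution of the system
`m x'' + (α / t ^ q) x' + γ (d/dt) ∇ₓL_t(x, l) + t ^ s ∇ₓL_t(x, l) = 0`,
`l' - (α - 1) (t ^ (q + s) - γ q t ^ (q - 1)) ∇ₗL_t(x + θ x', l) = 0`.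
Derivatives at `t₀` are one-sided; values of `x`, `l`, `m` below `t₀` are irrelevant. -/
structure IsGlobalSolution (f : X → ℝ) (A : X →L[ℝ] Y) (b : Y) (α γ c p q s t₀ : ℝ)
    (m : ℝ → ℝ) (x : ℝ → X) (l : ℝ → Y) : Prop where
  diff_x : DifferentiableOn ℝ x (Ici t₀)
  diff_x' : DifferentiableOn ℝ (derivWithin x (Ici t₀)) (Ici t₀)
  diff_grad : DifferentiableOn ℝ (fun t => gradPrimal f A b c p t (x t) (l t)) (Ici t₀)
  diff_l : DifferentiableOn ℝ l (Ici t₀)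
  primal : ∀ t ∈ Ici t₀,
    m t • derivWithin (derivWithin x (Ici t₀)) (Ici t₀) t
      + (α / t ^ q) • derivWithin x (Ici t₀) t
      + γ • derivWithin (fun τ => gradPrimal f A b c p τ (x τ) (l τ)) (Ici t₀) t
      + t ^ s • gradPrimal f A b c p t (x t) (l t) = 0
  dual : ∀ t ∈ Ici t₀,
    derivWithin l (Ici t₀) t
      - ((α - 1) * (t ^ (q + s) - γ * q * t ^ (q - 1))) •
          gradDual f A b c p t
            (x t + extrapolation α γ q s t₀ m t • derivWithin x (Ici t₀) t) (l t) = 0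

end System

end

/-! The trajectory is compared with the moving saddle points z_t of L_t rather than directly with
the limit. With ε(t) = c / t^p, the point z_t solves a monotone inclusion perturbed by ε(t) z
(`IsKKTPair`; the value 0 of the parameter describes Ω). Monotonicity alone
(`IsKKTPair.inner_smul_sub_le`) yields uniqueness, ‖z_t‖ ≤ ‖z*‖, strong convergence z_t → z*, and
the bound W / t on the speed of z_t.

Multiplied by t^q, the primal equation becomes first order for the momentum y = P x' + S ∇ₓL_t, with
P = t^q m and S = γ t^q: y' = -(α - μ) x' - δ ∇ₓL_t, where μ = P' and δ = t^(q+s) - γ q t^(q-1). The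
extrapolation θ is tuned so that (α - 1) δ θ = Θ := P δ + S (1 - μ). With the weight Θ on the primal
gap, every cross term in the derivative of the energy cancels for a frozen reference point
(`hasDerivAt_energy`). What is left is dissipation, supplied by the damping, the Hessian term and
the ε-strong convexity-concavity of L_t.

Moving the reference point costs terms linear in its speed W / t (`energy_le_energy_add`). Young's
inequality absorbs them (`dissipation_le`), so that, in the sense of upper right derivatives, E' ≤
-K t^(-r) E + C t^(-r) h with h = m t^(2q+s+σ+r). Here r ≥ p - q - s, because the decay rate cannot
exceed the order of t^(q+s) ε(t), and σ bounds the exponents of the source terms. Since r < 1, h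
varies slowly compared with t^(-r), and a barrier argument gives E ≤ N h
(`exists_le_mul_of_slope_lt`).

The energy dominates the squared distance to z_t, which yields the distance rate; with m = O(t^(-q))
it also yields strong convergence. The rates for objective and feasibility follow because f is
locally Lipschitz and z_t itself has error O(t^(-p)) (`isBigO_rates`). -/

section TikhonovLagrangian

/-! ### The Lagrangian with a general Tikhonov parameter. -/

variable {X Y : Type*} [NormedAddCommGroup X] [InnerProductSpace ℝ X]
  [NormedAddCommGroup Y] [InnerProductSpace ℝ Y]

/-- The Lagrangian with the regularization `e / 2 * (‖x‖ ^ 2 - ‖l‖ ^ 2)`. -/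
noncomputable def tikhonovLagrangian (f : X → ℝ) (A : X →L[ℝ] Y) (b : Y) (e : ℝ) (x : X) (l : Y) : ℝ :=
  lagrangian f A b x l + e / 2 * (‖x‖ ^ 2 - ‖l‖ ^ 2)

variable {f : X → ℝ} {A : X →L[ℝ] Y} {b : Y}

theorem regLagrangian_eq (c p t : ℝ) :
    regLagrangian f A b c p t = tikhonovLagrangian f A b (c / t ^ p) := by
  funext x l
  simp only [regLagrangian, tikhonovLagrangian]
  rw [div_div, mul_comm (2 : ℝ)]

theorem lagrangian_eq_tikhonovLagrangian :
    lagrangian f A b = tikhonovLagrangian f A b 0 := by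
  funext x l
  simp [tikhonovLagrangian]

/-- The function is quadratic in the dual variable, so its second-order expansion is exact. This
gives both the dual optimality condition and the cost of shifting the multiplier in the energy. -/
theorem tikhonovLagrangian_dual_eq (e : ℝ) (x : X) (l l' : Y) :
    tikhonovLagrangian f A b e x l' = tikhonovLagrangian f A b e x l
      + inner ℝ (l' - l) (A x - b - e • l) - e / 2 * ‖l' - l‖ ^ 2 := by
  simp only [tikhonovLagrangian, lagrangian, inner_sub_left, real_inner_smul_right,
    inner_sub_right, norm_sub_sq_real, real_inner_self_eq_norm_sq, real_inner_comm l l']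
  ring

theorem hasGradientAt_tikhonovLagrangian_dual [CompleteSpace Y] (e : ℝ) (x : X) (l : Y) :
    HasGradientAt (fun l' => tikhonovLagrangian f A b e x l')
      (A x - b - e • l) l := by
  rw [hasGradientAt_iff_hasFDerivAt]
  have h2 : HasFDerivAt (fun l' : Y => inner ℝ l' (A x - b)) (innerSL ℝ (A x - b)) l := by
    refine (innerSL ℝ (A x - b)).hasFDerivAt.congr_of_eventuallyEq (Eventually.of_forall fun l' => ?_)
    rw [innerSL_apply_apply, real_inner_comm]
  have h3 : HasFDerivAt (fun x' : Y => ‖x'‖ ^ 2) _ l := (hasStrictFDerivAt_norm_sq l).hasFDerivAt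
  refine ((h2.const_add (f x)).add ((h3.const_sub (‖x‖ ^ 2)).const_mul (e / 2))).congr_fderiv ?_
  ext y
  simp
  ring

end TikhonovLagrangian

/-! ### Regularized saddle points: existence, monotonicity, convergence to the minimal-norm
solution. -/

section ConvexAnalysis

variable {X Y : Type*} [NormedAddCommGroup X] [InnerProductSpace ℝ X] [CompleteSpace X]
  [NormedAddCommGroup Y] [InnerProductSpace ℝ Y] [CompleteSpace Y]

theorem ConvexOn.add_inner_gradient_le {f : X → ℝ} (hconv : ConvexOn ℝ univ f) {x : X}
    (hd : DifferentiableAt ℝ f x) (y : X) : f x + inner ℝ (gradient f x) (y - x) ≤ f y := by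
  have hg : ConvexOn ℝ univ (fun s : ℝ => f (AffineMap.lineMap x y s)) := by
    exact hconv.comp_affineMap (AffineMap.lineMap x y)
  have hl : HasDerivAt (fun s : ℝ => (AffineMap.lineMap x y s : X)) (y - x) 0 :=
    AffineMap.hasDerivAt_lineMap
  have hd' : HasFDerivAt f (fderiv ℝ f x) ((AffineMap.lineMap x y (0 : ℝ) : X)) := by
    simpa using hd.hasFDerivAt
  have h := hg.le_slope_of_hasDerivAt (mem_univ 0) (mem_univ 1) one_pos
    (hd'.comp_hasDerivAt (0 : ℝ) hl)
  simp only [slope_def_field, AffineMap.lineMap_apply_one, AffineMap.lineMap_apply_zero] at h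
  rw [inner_gradient_left]
  linarith

theorem ConvexOn.inner_gradient_sub_nonneg {f : X → ℝ} (hconv : ConvexOn ℝ univ f)
    (hd : Differentiable ℝ f) (x y : X) :
    0 ≤ inner ℝ (gradient f x - gradient f y) (x - y) := by
  have h1 := hconv.add_inner_gradient_le (hd x) y
  have h2 := hconv.add_inner_gradient_le (hd y) x
  have h3 : inner ℝ (gradient f x) (y - x) = - inner ℝ (gradient f x) (x - y) := by
    rw [← inner_neg_right, neg_sub]
  rw [inner_sub_left]
  linarith

/-- Uniform midpoint convexity makes every minimizing sequence Cauchy, so completeness suffices and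
no weak compactness is needed. -/
theorem exists_forall_le_of_midpoint {g : X → ℝ} (hg : Continuous g) (hb : BddBelow (range g))
    {k : ℝ} (hk : 0 < k)
    (hmid : ∀ x y, k * ‖x - y‖ ^ 2 + g ((2 : ℝ)⁻¹ • (x + y)) ≤ (g x + g y) / 2) :
    ∃ x, ∀ y, g x ≤ g y := by
  have hI : ∀ y, sInf (range g) ≤ g y := fun y => csInf_le hb (mem_range_self y)
  have hu : ∀ n : ℕ, ∃ x, g x < sInf (range g) + 1 / ((n : ℝ) + 1) := by
    intro n
    obtain ⟨_, ⟨x, rfl⟩, hx⟩ := exists_lt_of_csInf_lt (range_nonempty g)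
      (lt_add_of_pos_right (sInf (range g)) (Nat.one_div_pos_of_nat (α := ℝ) (n := n)))
    exact ⟨x, hx⟩
  choose u hu using hu
  have hu' : ∀ n N : ℕ, N ≤ n → g (u n) ≤ sInf (range g) + 1 / ((N : ℝ) + 1) := by
    intro n N hn
    refine (hu n).le.trans ?_
    gcongr
  have hlim := tendsto_one_div_add_atTop_nhds_zero_nat (𝕜 := ℝ)
  have hcau : CauchySeq u := by
    refine cauchySeq_of_le_tendsto_0 (fun N : ℕ => √(k⁻¹ * (1 / ((N : ℝ) + 1)))) ?_ ?_
    · intro n m N hn hm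
      rw [dist_eq_norm]
      apply Real.le_sqrt_of_sq_le
      have h1 := hmid (u n) (u m)
      have h2 := hI ((2 : ℝ)⁻¹ • (u n + u m))
      have h3 := hu' n N hn
      have h4 := hu' m N hm
      rw [← div_eq_inv_mul, le_div_iff₀ hk]
      linarith
    · have := ((hlim.const_mul k⁻¹).sqrt)
      simpa using this
  obtain ⟨x, hx⟩ := cauchySeq_tendsto_of_complete hcau
  refine ⟨x, fun y => (?_ : g x ≤ sInf (range g)).trans (hI y)⟩
  have h1 : Tendsto (fun n => g (u n)) atTop (𝓝 (g x)) := (hg.tendsto x).comp hx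
  have h2 : Tendsto (fun n : ℕ => sInf (range g) + 1 / ((n : ℝ) + 1)) atTop
      (𝓝 (sInf (range g))) := by simpa using hlim.const_add (sInf (range g))
  exact le_of_tendsto_of_tendsto' h1 h2 fun n => (hu n).le

/-- The first order optimality system of the saddle points of
`L(x, l) + e / 2 * (‖x‖ ^ 2 - ‖l‖ ^ 2)`. -/
structure IsKKTPair (f : X → ℝ) (A : X →L[ℝ] Y) (b : Y) (e : ℝ) (x : X) (l : Y) : Prop where
  primal : gradient f x + A.adjoint l + e • x = 0
  dual : A x - b = e • l

variable {f : X → ℝ} {A : X →L[ℝ] Y} {b : Y}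

theorem hasGradientAt_tikhonovLagrangian_primal (hd : Differentiable ℝ f) (e : ℝ) (x : X) (l : Y) :
    HasGradientAt (fun x' => tikhonovLagrangian f A b e x' l)
      (gradient f x + A.adjoint l + e • x) x := by
  rw [hasGradientAt_iff_hasFDerivAt]
  have h1 := (hd x).hasGradientAt.hasFDerivAt
  have h2 : HasFDerivAt (fun x' : X => inner ℝ l (A x' - b))
      ((innerSL ℝ l).comp A) x :=
    (innerSL ℝ l).hasFDerivAt.comp x (A.hasFDerivAt.sub_const b)
  have h3 : HasFDerivAt (fun x' : X => ‖x'‖ ^ 2) _ x := (hasStrictFDerivAt_norm_sq x).hasFDerivAt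
  refine ((h1.add h2).add ((h3.sub_const (‖l‖ ^ 2)).const_mul (e / 2))).congr_fderiv ?_
  ext y
  simp [ContinuousLinearMap.adjoint_inner_left]
  ring

/-- Strong convexity of the regularized Lagrangian in the primal variable. -/
theorem tikhonovLagrangian_add_inner_le (hconv : ConvexOn ℝ univ f) (hd : Differentiable ℝ f)
    (e : ℝ) (x y : X) (l : Y) :
    tikhonovLagrangian f A b e x l
      + inner ℝ (gradient f x + A.adjoint l + e • x) (y - x) + e / 2 * ‖y - x‖ ^ 2
      ≤ tikhonovLagrangian f A b e y l := by
  have h1 := hconv.add_inner_gradient_le (hd x) y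
  simp only [tikhonovLagrangian, lagrangian, inner_add_left, real_inner_smul_left,
    ContinuousLinearMap.adjoint_inner_left, inner_sub_right, norm_sub_sq_real,
    real_inner_self_eq_norm_sq, real_inner_comm x y] at h1 ⊢
  linarith

theorem isSaddlePt_tikhonovLagrangian_iff (hconv : ConvexOn ℝ univ f) (hd : Differentiable ℝ f)
    {e : ℝ} (he : 0 ≤ e) {z : WithLp 2 (X × Y)} :
    IsSaddlePt (tikhonovLagrangian f A b e) z ↔ IsKKTPair f A b e z.fst z.snd := by
  constructor
  · intro h
    constructor
    · have hmin : IsLocalMin (fun x' => tikhonovLagrangian f A b e x' z.snd) z.fst :=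
        Eventually.of_forall fun x' => (h x' z.snd).2
      have := hmin.hasFDerivAt_eq_zero
        (hasGradientAt_tikhonovLagrangian_primal hd e z.fst z.snd).hasFDerivAt
      exact (LinearIsometryEquiv.map_eq_zero_iff _).1 this
    · have hmax : IsLocalMax (fun l' => tikhonovLagrangian f A b e z.fst l') z.snd :=
        Eventually.of_forall fun l' => (h z.fst l').1
      have := hmax.hasFDerivAt_eq_zero
        (hasGradientAt_tikhonovLagrangian_dual (f := f) e z.fst z.snd).hasFDerivAt
      exact sub_eq_zero.1 ((LinearIsometryEquiv.map_eq_zero_iff _).1 this)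
  · intro h x' l'
    constructor
    · rw [tikhonovLagrangian_dual_eq e z.fst z.snd l', h.dual]
      simp only [sub_self, inner_zero_right, add_zero, sub_le_self_iff]
      positivity
    · have := tikhonovLagrangian_add_inner_le (A := A) (b := b) hconv hd e z.fst x' z.snd
      rw [h.primal, inner_zero_left] at this
      have h2 : 0 ≤ e / 2 * ‖x' - z.fst‖ ^ 2 := by positivity
      linarith

/-- Maximizing over the multiplier explicitly, at l = (A x - b) / e, leaves a strongly convex
function of x alone. The stationarity condition of its minimizer is the primal equation. -/
theorem exists_isKKTPair (hf : ContDiff ℝ 1 f) (hconv : ConvexOn ℝ univ f)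
    (A : X →L[ℝ] Y) (b : Y) {e : ℝ} (he : 0 < e) :
    ∃ z : WithLp 2 (X × Y), IsKKTPair f A b e z.fst z.snd := by
  have hd : Differentiable ℝ f := hf.differentiable one_ne_zero
  let g : X → ℝ := fun x => f x + e / 2 * ‖x‖ ^ 2 + (2 * e)⁻¹ * ‖A x - b‖ ^ 2
  have hcont : Continuous g := by
    have := hf.continuous
    fun_prop
  obtain ⟨x, hx⟩ : ∃ x, ∀ y, g x ≤ g y := by
    refine exists_forall_le_of_midpoint hcont
      -- The lower bound comes from the tangent of f at 0 and completing the square against e / 2 *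
      -- ‖y‖ ^ 2. The modulus e / 8 is e / 2 times the factor 1 / 4 in the parallelogram identity.
      ⟨f 0 - ‖gradient f 0‖ ^ 2 / (2 * e), ?_⟩ (k := e / 8) (by positivity) ?_
    · rintro _ ⟨y, rfl⟩
      have h1 := hconv.add_inner_gradient_le (hd 0) y
      rw [sub_zero] at h1
      have h2 : 0 ≤ ‖gradient f 0 + e • y‖ ^ 2 / (2 * e) := by positivity
      rw [norm_add_sq_real, real_inner_smul_right, norm_smul, Real.norm_of_nonneg he.le] at h2
      have h3 : (‖gradient f 0‖ ^ 2 + 2 * (e * inner ℝ (gradient f 0) y) + (e * ‖y‖) ^ 2) / (2 * e)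
          = ‖gradient f 0‖ ^ 2 / (2 * e) + inner ℝ (gradient f 0) y + e / 2 * ‖y‖ ^ 2 := by
        field_simp
      have h4 : 0 ≤ (2 * e)⁻¹ * ‖A y - b‖ ^ 2 := by positivity
      simp only [g]
      linarith
    · intro y z
      have h1 := hconv.2 (mem_univ y) (mem_univ z) (by norm_num : (0 : ℝ) ≤ 2⁻¹)
        (by norm_num : (0 : ℝ) ≤ 2⁻¹) (by norm_num)
      rw [← smul_add] at h1
      have h2 : ‖(2 : ℝ)⁻¹ • (y + z)‖ ^ 2 = (‖y‖ ^ 2 + ‖z‖ ^ 2) / 2 - ‖y - z‖ ^ 2 / 4 := by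
        rw [norm_smul, mul_pow, norm_add_sq_real, norm_sub_sq_real]
        norm_num
        ring
      have h3 : ‖A ((2 : ℝ)⁻¹ • (y + z)) - b‖ ^ 2
          ≤ (‖A y - b‖ ^ 2 + ‖A z - b‖ ^ 2) / 2 := by
        have h4 : A ((2 : ℝ)⁻¹ • (y + z)) - b = (2 : ℝ)⁻¹ • ((A y - b) + (A z - b)) := by
          rw [map_smul, map_add]
          module
        rw [h4, norm_smul, mul_pow]
        have := parallelogram_law_with_norm ℝ (A y - b) (A z - b)
        norm_num
        nlinarith [sq_nonneg ‖(A y - b) - (A z - b)‖]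
      have h5 := mul_le_mul_of_nonneg_left h3 (by positivity : 0 ≤ (2 * e)⁻¹)
      simp only [g, h2]
      simp only [smul_eq_mul] at h1
      linarith
  refine ⟨WithLp.toLp 2 (x, e⁻¹ • (A x - b)), ?_, ?_⟩
  · have h1 := (hd x).hasGradientAt.hasFDerivAt
    have h2 : HasFDerivAt (fun x' : X => ‖x'‖ ^ 2) _ x := (hasStrictFDerivAt_norm_sq x).hasFDerivAt
    have h3 : HasFDerivAt (fun x' : X => ‖A x' - b‖ ^ 2) ((2 • innerSL ℝ (A x - b)).comp A) x :=
      HasFDerivAt.comp (g := fun y : Y => ‖y‖ ^ 2) x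
        (hasStrictFDerivAt_norm_sq (A x - b)).hasFDerivAt (A.hasFDerivAt.sub_const b)
    have hmin : IsLocalMin g x := Eventually.of_forall hx
    have h4 := hmin.hasFDerivAt_eq_zero
      ((h1.add (h2.const_mul (e / 2))).add (h3.const_mul (2 * e)⁻¹))
    simp only [WithLp.toLp_fst, WithLp.toLp_snd]
    refine ext_inner_right ℝ fun y => ?_
    have h5 := DFunLike.congr_fun h4 y
    simp only [add_apply, smul_apply,
      InnerProductSpace.toDual_apply_apply, ContinuousLinearMap.comp_apply, innerSL_apply_apply,
      nsmul_eq_mul, smul_eq_mul, zero_apply, Nat.cast_ofNat] at h5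
    rw [inner_zero_left, ← h5, inner_add_left, inner_add_left,
      ContinuousLinearMap.adjoint_inner_left, real_inner_smul_left, real_inner_smul_left]
    field_simp
    ring
  · simp [smul_smul, he.ne']

/-- The gradient of f is monotone and the coupling through A is skew, so the optimality operator is
monotone. Subtracting two optimality systems leaves only the regularization terms. -/
theorem IsKKTPair.inner_smul_sub_le (hconv : ConvexOn ℝ univ f) (hd : Differentiable ℝ f)
    {e₁ e₂ : ℝ} {z w : WithLp 2 (X × Y)} (hz : IsKKTPair f A b e₁ z.fst z.snd)
    (hw : IsKKTPair f A b e₂ w.fst w.snd) :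
    inner ℝ (e₁ • z - e₂ • w) (z - w) ≤ 0 := by
  have h := hconv.inner_gradient_sub_nonneg hd z.fst w.fst
  have h1 : e₁ • z.fst - e₂ • w.fst
      = -(gradient f z.fst - gradient f w.fst) - A.adjoint (z.snd - w.snd) := by
    rw [eq_neg_of_add_eq_zero_right hz.primal, eq_neg_of_add_eq_zero_right hw.primal, map_sub]
    abel
  have h2 : e₁ • z.snd - e₂ • w.snd = A (z.fst - w.fst) := by
    rw [← hz.dual, ← hw.dual, map_sub]
    abel
  rw [WithLp.prod_inner_apply]
  change inner ℝ (e₁ • z.fst - e₂ • w.fst) (z.fst - w.fst)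
    + inner ℝ (e₁ • z.snd - e₂ • w.snd) (z.snd - w.snd) ≤ 0
  rw [h1, h2, inner_sub_left, inner_neg_left, ContinuousLinearMap.adjoint_inner_left,
    real_inner_comm (A (z.fst - w.fst))]
  linarith

/-- Quantitative stability in the parameter: it bounds the speed of the regularized saddle points,
and e₁ = e₂ gives uniqueness. -/
theorem IsKKTPair.norm_sub_le (hconv : ConvexOn ℝ univ f) (hd : Differentiable ℝ f)
    {e₁ e₂ : ℝ} (he₁ : 0 < e₁) (he : e₁ ≤ e₂) {z w : WithLp 2 (X × Y)}
    (hz : IsKKTPair f A b e₁ z.fst z.snd) (hw : IsKKTPair f A b e₂ w.fst w.snd) :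
    ‖z - w‖ ≤ (e₂ / e₁ - 1) * ‖w‖ := by
  have h := hz.inner_smul_sub_le hconv hd hw
  have h1 : e₁ • z - e₂ • w = e₁ • (z - w) - (e₂ - e₁) • w := by module
  rw [h1, inner_sub_left, real_inner_smul_left, real_inner_smul_left, real_inner_self_eq_norm_sq]
    at h
  have h2 := mul_le_mul_of_nonneg_left (real_inner_le_norm w (z - w)) (sub_nonneg.2 he)
  have h3 : (e₂ / e₁ - 1) * ‖w‖ = (e₂ - e₁) * ‖w‖ / e₁ := by field_simp
  rw [h3, le_div_iff₀ he₁]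
  rcases (norm_nonneg (z - w)).eq_or_lt with h0 | h0
  · rw [← h0, zero_mul]
    exact mul_nonneg (sub_nonneg.2 he) (norm_nonneg w)
  · nlinarith

/-- Monotonicity forces ⟨w, z - w⟩ ≥ 0 when w carries the larger parameter. Hence norms grow as the
regularization weakens and the growth controls the distance; e₁ = 0 bounds them by the norm of any
solution. -/
theorem IsKKTPair.norm_sq_add_le (hconv : ConvexOn ℝ univ f) (hd : Differentiable ℝ f)
    {e₁ e₂ : ℝ} (he₁ : 0 ≤ e₁) (he : e₁ < e₂) {z w : WithLp 2 (X × Y)}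
    (hz : IsKKTPair f A b e₁ z.fst z.snd) (hw : IsKKTPair f A b e₂ w.fst w.snd) :
    ‖w‖ ^ 2 + ‖z - w‖ ^ 2 ≤ ‖z‖ ^ 2 := by
  have h := hz.inner_smul_sub_le hconv hd hw
  have h1 : e₁ • z - e₂ • w = e₁ • (z - w) - (e₂ - e₁) • w := by module
  rw [h1, inner_sub_left, real_inner_smul_left, real_inner_smul_left, real_inner_self_eq_norm_sq]
    at h
  have h2 : 0 ≤ inner ℝ w (z - w) := by
    by_contra! hlt
    nlinarith [sq_nonneg ‖z - w‖]
  have h3 : ‖z‖ ^ 2 = ‖w‖ ^ 2 + 2 * inner ℝ w (z - w) + ‖z - w‖ ^ 2 := by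
    rw [← norm_add_sq_real, add_sub_cancel]
  linarith

theorem IsKKTPair.unique (hconv : ConvexOn ℝ univ f) (hd : Differentiable ℝ f)
    {e : ℝ} (he : 0 < e) {z w : WithLp 2 (X × Y)} (hz : IsKKTPair f A b e z.fst z.snd)
    (hw : IsKKTPair f A b e w.fst w.snd) : z = w := by
  have := hz.norm_sub_le hconv hd he le_rfl hw
  rw [div_self he.ne', sub_self, zero_mul] at this
  exact sub_eq_zero.1 (norm_le_zero_iff.1 this)

theorem mem_primalDualSolutions_iff (hconv : ConvexOn ℝ univ f) (hd : Differentiable ℝ f)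
    {z : WithLp 2 (X × Y)} :
    z ∈ primalDualSolutions f A b ↔ IsKKTPair f A b 0 z.fst z.snd := by
  rw [← isSaddlePt_tikhonovLagrangian_iff hconv hd le_rfl, ← lagrangian_eq_tikhonovLagrangian]
  rfl

/-- The Tikhonov trajectory converges strongly to the primal-dual solution of minimal norm. -/
theorem exists_tendsto_isKKTPair (hf : ContDiff ℝ 1 f) (hconv : ConvexOn ℝ univ f)
    (hΩ : (primalDualSolutions f A b).Nonempty) {ε : ℝ → ℝ} {T : ℝ}
    (hpos : ∀ t ∈ Ici T, 0 < ε t) (hanti : StrictAntiOn ε (Ici T))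
    (hε : Tendsto ε atTop (𝓝 0)) {zt : ℝ → WithLp 2 (X × Y)}
    (hzt : ∀ t ∈ Ici T, IsKKTPair f A b (ε t) (zt t).fst (zt t).snd) :
    ∃ zs, Tendsto zt atTop (𝓝 zs) ∧ IsProjOnto (primalDualSolutions f A b) 0 zs ∧
      (∀ t ∈ Ici T, ‖zt t‖ ≤ ‖zs‖) ∧
      ∀ w, IsProjOnto (primalDualSolutions f A b) 0 w → w = zs := by
  have hd : Differentiable ℝ f := hf.differentiable one_ne_zero
  have hle : ∀ w ∈ primalDualSolutions f A b, ∀ t ∈ Ici T,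
      ‖zt t‖ ^ 2 + ‖w - zt t‖ ^ 2 ≤ ‖w‖ ^ 2 := fun w hw t ht =>
    ((mem_primalDualSolutions_iff hconv hd).1 hw).norm_sq_add_le hconv hd le_rfl (hpos t ht)
      (hzt t ht)
  have hmono : ∀ t ∈ Ici T, ∀ u ∈ Ici T, t ≤ u → ‖zt t‖ ^ 2 + ‖zt u - zt t‖ ^ 2 ≤ ‖zt u‖ ^ 2 := by
    intro t ht u hu htu
    rcases htu.eq_or_lt with rfl | h
    · simp
    · exact (hzt u hu).norm_sq_add_le hconv hd (hpos u hu).le (hanti ht hu h) (hzt t ht)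
  obtain ⟨w₀, hw₀⟩ := hΩ
  -- Clamping the time at T makes the squared norm monotone on all of ℝ. Its bounded increments then
  -- dominate squared distances, which gives the Cauchy property.
  let N : ℝ → ℝ := fun t => ‖zt (max t T)‖ ^ 2
  have hN : Monotone N := fun t u htu => by
    have := hmono _ (le_max_right t T) _ (le_max_right u T) (max_le_max_right T htu)
    simp only [N]
    nlinarith [sq_nonneg ‖zt (max u T) - zt (max t T)‖]
  have hNb : BddAbove (range N) := by
    refine ⟨‖w₀‖ ^ 2, ?_⟩
    rintro _ ⟨t, rfl⟩
    have := hle w₀ hw₀ _ (le_max_right t T)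
    simp only [N]
    nlinarith [sq_nonneg ‖w₀ - zt (max t T)‖]
  have hNlim := tendsto_atTop_ciSup hN hNb
  set B := ⨆ t, N t with hB
  have hcau : CauchySeq (fun t => zt (max t T)) := by
    refine cauchySeq_of_le_tendsto_0 (fun t => 2 * √(B - N t)) ?_ ?_
    · have key : ∀ t u, t ≤ u → ‖zt (max u T) - zt (max t T)‖ ≤ √(B - N t) := by
        intro t u htu
        apply Real.le_sqrt_of_sq_le
        have := hmono _ (le_max_right t T) _ (le_max_right u T) (max_le_max_right T htu)
        have h2 : N u ≤ B := le_ciSup hNb u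
        simp only [N] at h2 ⊢
        linarith
      intro n m t hn hm
      have h1 := key t n hn
      have h2 := key t m hm
      rw [dist_eq_norm]
      have h3 := norm_sub_le (zt (max n T) - zt (max t T)) (zt (max m T) - zt (max t T))
      rw [sub_sub_sub_cancel_right] at h3
      linarith
    · have := ((hNlim.const_sub B).sqrt).const_mul 2
      simpa using this
  obtain ⟨zs, hzs⟩ := cauchySeq_tendsto_of_complete hcau
  have hzs' : Tendsto zt atTop (𝓝 zs) := by
    refine hzs.congr' ?_
    filter_upwards [eventually_ge_atTop T] with t ht
    rw [max_eq_left ht]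
  have hev : ∀ᶠ t in atTop, t ∈ Ici T := eventually_ge_atTop T
  have hmem : zs ∈ primalDualSolutions f A b := by
    rw [mem_primalDualSolutions_iff hconv hd]
    have hfst : Tendsto (fun t => (zt t).fst) atTop (𝓝 zs.fst) :=
      ((WithLp.prod_continuous_ofLp 2 X Y).tendsto zs |>.comp hzs').fst_nhds
    have hsnd : Tendsto (fun t => (zt t).snd) atTop (𝓝 zs.snd) :=
      ((WithLp.prod_continuous_ofLp 2 X Y).tendsto zs |>.comp hzs').snd_nhds
    have hgrad : Continuous (gradient f) := by
      have := hf.continuous_fderiv one_ne_zero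
      exact (InnerProductSpace.toDual ℝ X).symm.continuous.comp this
    constructor
    · refine tendsto_nhds_unique (((hgrad.tendsto _).comp hfst).add
        ((A.adjoint.continuous.tendsto _).comp hsnd) |>.add (hε.smul hfst)) ?_
      refine tendsto_const_nhds.congr' ?_
      filter_upwards [hev] with t ht using (hzt t ht).primal.symm
    · refine tendsto_nhds_unique (((A.continuous.tendsto _).comp hfst).sub_const b) ?_
      refine (hε.smul hsnd).congr' ?_
      filter_upwards [hev] with t ht using (hzt t ht).dual.symm
  have hlim_le : ∀ w ∈ primalDualSolutions f A b, ‖zs‖ ^ 2 + ‖w - zs‖ ^ 2 ≤ ‖w‖ ^ 2 := by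
    intro w hw
    refine le_of_tendsto (((hzs'.norm.pow 2)).add ((hzs'.const_sub w).norm.pow 2)) ?_
    filter_upwards [hev] with t ht using hle w hw t ht
  have hproj : IsProjOnto (primalDualSolutions f A b) 0 zs := by
    refine ⟨hmem, fun w hw => ?_⟩
    rw [zero_sub, zero_sub, norm_neg, norm_neg]
    have := hlim_le w hw
    refine le_of_sq_le_sq ?_ (norm_nonneg w)
    nlinarith [sq_nonneg ‖w - zs‖]
  refine ⟨zs, hzs', hproj, fun t ht => ?_, fun w hw => ?_⟩
  · refine le_of_sq_le_sq ?_ (norm_nonneg zs)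
    nlinarith [hle zs hmem t ht, sq_nonneg ‖zs - zt t‖]
  · have h1 := hw.2 zs hmem
    rw [zero_sub, zero_sub, norm_neg, norm_neg] at h1
    have h2 := hlim_le w hw.1
    have h3 : ‖w‖ ^ 2 ≤ ‖zs‖ ^ 2 := by gcongr
    have h4 : ‖w - zs‖ ^ 2 ≤ 0 := by linarith
    have h5 : ‖w - zs‖ = 0 := by
      have := le_antisymm h4 (sq_nonneg _)
      exact pow_eq_zero_iff two_ne_zero |>.1 this
    exact sub_eq_zero.1 (norm_eq_zero.1 h5)

end ConvexAnalysis

/-! ### The energy: derivative for a fixed reference point, cost of moving that point. -/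

section Energy

variable {X Y : Type*} [NormedAddCommGroup X] [InnerProductSpace ℝ X]
  [NormedAddCommGroup Y] [InnerProductSpace ℝ Y]

/-- The Lyapunov function of the trajectory `(x, l)` relative to the reference point `(xb, lb)`;
`y` is the momentum variable. -/
noncomputable def energy (f : X → ℝ) (A : X →L[ℝ] Y) (b : Y) (a e Θ μ : ℝ) (x y : X) (l : Y) (xb : X) (lb : Y) :
    ℝ :=
  Θ * (tikhonovLagrangian f A b e x lb - tikhonovLagrangian f A b e xb lb)
    + ‖a • (x - xb) + y‖ ^ 2 / 2 + a * (1 - μ) / 2 * ‖x - xb‖ ^ 2 + ‖l - lb‖ ^ 2 / 2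

variable {f : X → ℝ} {A : X →L[ℝ] Y} {b : Y}

/-- The ⟨ξ, u⟩ term is cancelled by the quadratic term a (1 - μ) / 2 * ‖ξ‖ ^ 2 of the energy. The
coefficient of ⟨G, u⟩ dictates the weight Θ of the gap. -/
theorem inner_momentum_eq (a δ P S μ : ℝ) (ξ u G : X) :
    inner ℝ (a • ξ + (P • u + S • G)) (a • u + (-(a + 1 - μ) • u - δ • G))
      = -(a * (1 - μ) * inner ℝ ξ u) - a * δ * inner ℝ G ξ - P * (1 - μ) * ‖u‖ ^ 2
        - (P * δ + S * (1 - μ)) * inner ℝ G u - δ * S * ‖G‖ ^ 2 := by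
  simp only [inner_add_left, inner_add_right, inner_sub_right, real_inner_smul_left,
    real_inner_smul_right, real_inner_self_eq_norm_sq, real_inner_comm G ξ, real_inner_comm G u]
  ring

/-- The derivative of the energy relative to a fixed reference point. -/
theorem hasDerivAt_energy [CompleteSpace X] [CompleteSpace Y] (hd : Differentiable ℝ f)
    {a δ P S e' Θ' μ' t : ℝ}
    {ε Θ μ : ℝ → ℝ} {x y : ℝ → X} {l : ℝ → Y} {u G : X} {xb : X} {lb : Y}
    (hε : HasDerivAt ε e' t) (hΘ : HasDerivAt Θ Θ' t) (hμ : HasDerivAt μ μ' t)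
    (hx : HasDerivAt x u t) (hy : HasDerivAt y (-(a + 1 - μ t) • u - δ • G) t)
    (hl : HasDerivAt l ((a * δ) • (A (x t) - b - ε t • l t) + Θ t • A u) t)
    (hG : G = gradient f (x t) + A.adjoint (l t) + ε t • x t)
    (hyt : y t = P • u + S • G) (hΘt : Θ t = P * δ + S * (1 - μ t))
    (hb : A xb - b = ε t • lb) :
    HasDerivAt (fun τ => energy f A b a (ε τ) (Θ τ) (μ τ) (x τ) (y τ) (l τ) xb lb)
      (Θ' * (tikhonovLagrangian f A b (ε t) (x t) lb - tikhonovLagrangian f A b (ε t) xb lb)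
        + Θ t * (e' / 2 * (‖x t‖ ^ 2 - ‖xb‖ ^ 2))
        - a * δ * inner ℝ (gradient f (x t) + A.adjoint lb + ε t • x t) (x t - xb)
        - P * (1 - μ t) * ‖u‖ ^ 2 - δ * S * ‖G‖ ^ 2 - a * δ * ε t * ‖l t - lb‖ ^ 2
        - a * μ' / 2 * ‖x t - xb‖ ^ 2) t := by
  have hfx : HasDerivAt (fun τ => f (x τ)) (inner ℝ (gradient f (x t)) u) t := by
    rw [inner_gradient_left]
    exact (hd (x t)).hasFDerivAt.comp_hasDerivAt t hx
  have hAx : HasDerivAt (fun τ => inner ℝ lb (A (x τ) - b)) (inner ℝ lb (A u)) t :=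
    (innerSL ℝ lb).hasFDerivAt.comp_hasDerivAt t
      ((A.hasFDerivAt.comp_hasDerivAt t hx).sub_const b)
  have h1 := (hfx.add hAx).add
    ((hε.div_const 2).mul ((hx.norm_sq).sub_const (‖lb‖ ^ 2)))
  have h2 := ((hε.div_const 2).mul_const (‖xb‖ ^ 2 - ‖lb‖ ^ 2)).const_add
    (f xb + inner ℝ lb (A xb - b))
  have h3 := (((hx.sub_const xb).const_smul a).add hy).norm_sq.div_const 2
  have h4 := (((hμ.const_sub 1).const_mul a).div_const 2).mul (hx.sub_const xb).norm_sq
  have h5 := (hl.sub_const lb).norm_sq.div_const 2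
  refine (((hΘ.mul (h1.sub h2)).add h3).add h4 |>.add h5).congr_deriv ?_
  have e1 : inner ℝ (a • (x t - xb) + y t) (a • u + (-(a + 1 - μ t) • u - δ • G))
      = -(a * (1 - μ t) * inner ℝ (x t - xb) u) - a * δ * inner ℝ G (x t - xb)
        - P * (1 - μ t) * ‖u‖ ^ 2 - (P * δ + S * (1 - μ t)) * inner ℝ G u - δ * S * ‖G‖ ^ 2 := by
    rw [hyt]; exact inner_momentum_eq a δ P S (μ t) (x t - xb) u G
  have e2 : A (x t) - b - ε t • l t = A (x t - xb) - ε t • (l t - lb) := by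
    rw [map_sub, smul_sub, ← hb]; abel
  -- The dissipation uses the gradient at the reference multiplier, while G is taken at the current
  -- one. The mismatch ⟨l - lb, A z⟩ cancels against the dual equation, for z = u and for z = x -
  -- xb.
  have e3 : ∀ z : X, inner ℝ G z
      = inner ℝ (gradient f (x t) + A.adjoint lb + ε t • x t) z + inner ℝ (l t - lb) (A z) := by
    intro z
    rw [hG, ← ContinuousLinearMap.adjoint_inner_left, ← inner_add_left, map_sub]
    congr 1
    abel
  have e4 : inner ℝ (gradient f (x t) + A.adjoint lb + ε t • x t) u
      = inner ℝ (gradient f (x t)) u + inner ℝ lb (A u) + ε t * inner ℝ (x t) u := by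
    rw [inner_add_left, inner_add_left, ContinuousLinearMap.adjoint_inner_left,
      real_inner_smul_left]
  have e5 := e3 u
  rw [e4] at e5
  have e6 := e3 (x t - xb)
  have e7 : inner ℝ (l t - lb) ((a * δ) • (A (x t) - b - ε t • l t) + Θ t • A u)
      = a * δ * (inner ℝ (l t - lb) (A (x t - xb)) - ε t * ‖l t - lb‖ ^ 2)
        + Θ t * inner ℝ (l t - lb) (A u) := by
    rw [e2, inner_add_right, real_inner_smul_right, real_inner_smul_right,
      inner_sub_right, real_inner_smul_right, real_inner_self_eq_norm_sq]
  simp only [Pi.add_apply, Pi.smul_apply, Pi.sub_apply, Pi.mul_apply]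
  rw [e1, e7, e5, e6, ← hΘt]
  simp only [tikhonovLagrangian, lagrangian]
  ring

theorem norm_add_sq_le_of_norm_le {E : Type*} [SeminormedAddCommGroup E] (v w : E) (k : ℝ)
    (hw : ‖w‖ ≤ k) : ‖v + w‖ ^ 2 ≤ ‖v‖ ^ 2 + 2 * k * ‖v‖ + k ^ 2 := by
  have h : ‖v + w‖ ≤ ‖v‖ + k := (norm_add_le v w).trans (by gcongr)
  calc ‖v + w‖ ^ 2 ≤ (‖v‖ + k) ^ 2 := by gcongr
    _ = _ := by ring

/-- The cost of moving the reference point along the regularized saddle points. -/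
theorem energy_le_energy_add {a e₀ e₁ Θ μ ρ W : ℝ} (ha : 0 ≤ a) (he₁ : 0 ≤ e₁)
    (hΘ : 0 ≤ Θ) (hμ : μ ≤ 1) {x y : X} {l : Y} {z₀ z₁ : WithLp 2 (X × Y)}
    (h₀ : IsSaddlePt (tikhonovLagrangian f A b e₀) z₀)
    (h₁ : IsSaddlePt (tikhonovLagrangian f A b e₁) z₁)
    (hρ : ‖z₁ - z₀‖ ≤ ρ) (hW₀ : ‖z₀‖ ≤ W) (hW₁ : ‖z₁‖ ≤ W) :
    energy f A b a e₁ Θ μ x y l z₁.fst z₁.snd ≤ energy f A b a e₁ Θ μ x y l z₀.fst z₀.snd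
      + (Θ * (ρ * ‖A x - b - e₁ • z₀.snd‖ + |e₁ - e₀| * W * ρ)
        + (a * ρ * ‖a • (x - z₀.fst) + y‖ + a ^ 2 * ρ ^ 2 / 2)
        + a * (1 - μ) / 2 * (2 * ρ * ‖x - z₀.fst‖ + ρ ^ 2) + (ρ * ‖l - z₀.snd‖ + ρ ^ 2 / 2)) := by
  have hρ0 : 0 ≤ ρ := (norm_nonneg _).trans hρ
  have hfst : ‖z₀.fst - z₁.fst‖ ≤ ρ := by
    rw [norm_sub_rev]
    exact (WithLp.norm_fst_le ..).trans hρ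
  have hsnd : ‖z₁.snd - z₀.snd‖ ≤ ρ := (WithLp.norm_snd_le ..).trans hρ
  have hW0' : ‖z₀.fst‖ ≤ W := (WithLp.norm_fst_le ..).trans hW₀
  have hW1' : ‖z₁.fst‖ ≤ W := (WithLp.norm_fst_le ..).trans hW₁
  have hW : 0 ≤ W := (norm_nonneg _).trans hW₀
  have q1 : ‖a • (x - z₁.fst) + y‖ ^ 2 ≤ ‖a • (x - z₀.fst) + y‖ ^ 2
      + 2 * (a * ρ) * ‖a • (x - z₀.fst) + y‖ + (a * ρ) ^ 2 := by
    have := norm_add_sq_le_of_norm_le (a • (x - z₀.fst) + y) (a • (z₀.fst - z₁.fst)) (a * ρ)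
      (by rw [norm_smul, Real.norm_of_nonneg ha]; gcongr)
    rwa [show a • (x - z₀.fst) + y + a • (z₀.fst - z₁.fst) = a • (x - z₁.fst) + y by module]
      at this
  have q2 : ‖x - z₁.fst‖ ^ 2 ≤ ‖x - z₀.fst‖ ^ 2 + 2 * ρ * ‖x - z₀.fst‖ + ρ ^ 2 := by
    have := norm_add_sq_le_of_norm_le (x - z₀.fst) (z₀.fst - z₁.fst) ρ hfst
    rwa [sub_add_sub_cancel] at this
  have q3 : ‖l - z₁.snd‖ ^ 2 ≤ ‖l - z₀.snd‖ ^ 2 + 2 * ρ * ‖l - z₀.snd‖ + ρ ^ 2 := by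
    have := norm_add_sq_le_of_norm_le (l - z₀.snd) (z₀.snd - z₁.snd) ρ (by rwa [norm_sub_rev] at hsnd)
    rwa [sub_add_sub_cancel] at this
  have q4 : tikhonovLagrangian f A b e₁ x z₁.snd - tikhonovLagrangian f A b e₁ x z₀.snd
      ≤ ρ * ‖A x - b - e₁ • z₀.snd‖ := by
    rw [tikhonovLagrangian_dual_eq e₁ x z₀.snd z₁.snd]
    have h1 := (real_inner_le_norm (z₁.snd - z₀.snd) (A x - b - e₁ • z₀.snd)).trans
      (mul_le_mul_of_nonneg_right hsnd (norm_nonneg _))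
    have h2 : 0 ≤ e₁ / 2 * ‖z₁.snd - z₀.snd‖ ^ 2 := by positivity
    linarith
  -- Using both saddle inequalities, rather than derivatives, makes this change second order: it is
  -- a product of the parameter increment and the displacement, so it vanishes in the right
  -- derivative.
  have q5 : tikhonovLagrangian f A b e₁ z₀.fst z₀.snd - tikhonovLagrangian f A b e₁ z₁.fst z₁.snd
      ≤ |e₁ - e₀| * W * ρ := by
    have h1 := (h₁ z₁.fst z₀.snd).1
    have h2 := (h₀ z₁.fst z₀.snd).2
    have h3 : (e₁ - e₀) / 2 * (‖z₀.fst‖ ^ 2 - ‖z₁.fst‖ ^ 2) ≤ |e₁ - e₀| * W * ρ := by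
      have h4 : |‖z₀.fst‖ ^ 2 - ‖z₁.fst‖ ^ 2| ≤ 2 * W * ρ := by
        rw [sq_sub_sq, abs_mul]
        have h5 := (abs_norm_sub_norm_le z₀.fst z₁.fst).trans hfst
        have h6 : |‖z₀.fst‖ + ‖z₁.fst‖| ≤ 2 * W := by
          rw [abs_of_nonneg (by positivity)]
          linarith
        gcongr
      calc (e₁ - e₀) / 2 * (‖z₀.fst‖ ^ 2 - ‖z₁.fst‖ ^ 2)
          ≤ |(e₁ - e₀) / 2 * (‖z₀.fst‖ ^ 2 - ‖z₁.fst‖ ^ 2)| := le_abs_self _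
        _ = |e₁ - e₀| / 2 * |‖z₀.fst‖ ^ 2 - ‖z₁.fst‖ ^ 2| := by
          rw [abs_mul, abs_div, abs_two]
        _ ≤ |e₁ - e₀| / 2 * (2 * W * ρ) := by gcongr
        _ = |e₁ - e₀| * W * ρ := by ring
    simp only [tikhonovLagrangian] at h1 h2 ⊢
    linarith
  have q6 := (h₁ z₀.fst z₁.snd).1
  have q8 : (tikhonovLagrangian f A b e₁ x z₁.snd - tikhonovLagrangian f A b e₁ z₁.fst z₁.snd)
      ≤ (tikhonovLagrangian f A b e₁ x z₀.snd - tikhonovLagrangian f A b e₁ z₀.fst z₀.snd)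
        + (ρ * ‖A x - b - e₁ • z₀.snd‖ + |e₁ - e₀| * W * ρ) := by linarith
  have q9 := mul_le_mul_of_nonneg_left q8 hΘ
  have q10 := mul_le_mul_of_nonneg_left q2
    (by have := mul_nonneg ha (sub_nonneg.2 hμ); linarith : 0 ≤ a * (1 - μ) / 2)
  simp only [energy]
  linarith

end Energy

/-! ### Real-variable tools: right slopes, dissipation, barrier comparison. -/

theorem eventually_slope_lt {E F g : ℝ → ℝ} {t d : ℝ} (hF : HasDerivAt F d t)
    (hg : ContinuousAt g t) (heq : E t = F t)
    (hle : ∀ᶠ τ in 𝓝[>] t, E τ ≤ F τ + (τ - t) * g τ) {r : ℝ} (hr : d + g t < r) :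
    ∀ᶠ τ in 𝓝[>] t, slope E t τ < r := by
  have h1 : Tendsto (slope F t) (𝓝[>] t) (𝓝 d) :=
    (hasDerivAt_iff_tendsto_slope.1 hF).mono_left (nhdsWithin_mono t fun τ hτ => ne_of_gt hτ)
  have h2 : Tendsto (fun τ => slope F t τ + g τ) (𝓝[>] t) (𝓝 (d + g t)) :=
    h1.add (hg.tendsto.mono_left nhdsWithin_le_nhds)
  filter_upwards [h2.eventually_lt_const hr, hle, self_mem_nhdsWithin] with τ h3 h4 h5
  refine lt_of_le_of_lt ?_ h3
  have h6 : 0 < τ - t := sub_pos.2 h5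
  rw [slope_def_field, slope_def_field, heq, div_add' _ _ _ h6.ne']
  gcongr
  linarith

theorem mul_le_young {k : ℝ} (hk : 0 < k) (c z : ℝ) :
    c * z ≤ k * (z ^ 2 / 2) + c ^ 2 / (2 * k) := by
  have h : k * (z ^ 2 / 2) + c ^ 2 / (2 * k) - c * z = (k * z - c) ^ 2 / (2 * k) := by
    field_simp
    ring
  have : 0 ≤ (k * z - c) ^ 2 / (2 * k) := by positivity
  linarith

set_option maxHeartbeats 1000000 in
/-- The dissipation inequality behind the decay of the energy. -/
theorem dissipation_le {a T e κ δ P S Θ Θ' μ μ' e' R N W K k₁ C₁ C₂ C₃ D I ξ U G η V B : ℝ}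
    (ha : 0 < a) (hT : 0 < T) (he : 0 < e) (hκ : 0 < κ) (hκ1 : κ ≤ 1) (hκe : κ ≤ C₁ * (T * e))
    (hδ : T / 2 ≤ δ) (hP : 0 ≤ P) (hPk : P ≤ k₁) (hS : 0 ≤ S) (hSC : S ≤ C₂ * T)
    (hΘ : 0 ≤ Θ) (hΘC : Θ ≤ C₃ * T) (hΘ' : Θ' ≤ a * T / 4) (hμ : |μ| ≤ 1 / 2)
    (hμ' : |μ'| ≤ T * e / 8) (he' : e' ≤ 0) (hR : 0 ≤ R)
    (hK : 0 < K) (hK1 : K * C₃ ≤ a / 4) (hK2 : K * C₁ * (3 * a ^ 2 + 3 * a / 2) ≤ a / 8)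
    (hK3 : 3 * K * k₁ ≤ 1 / 2) (hK4 : 3 * K * C₂ ≤ 1 / 2) (hK5 : K * C₁ ≤ a / 2)
    (hD : 0 ≤ D) (hI : D + e / 2 * ξ ^ 2 ≤ I) (hN : -W ^ 2 ≤ N) (hξ : 0 ≤ ξ)
    (hV : V ^ 2 ≤ 3 * (a ^ 2 * ξ ^ 2 + P ^ 2 * U ^ 2 + S ^ 2 * G ^ 2)) :
    Θ' * D + Θ * (e' / 2 * N) - a * δ * I - P * (1 - μ) * U ^ 2 - δ * S * G ^ 2
        - a * δ * e * η ^ 2 - a * μ' / 2 * ξ ^ 2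
        + (Θ * R * B * ξ + a * R * V + a * (1 - μ) * R * ξ + R * η)
      ≤ -(K * κ) * (Θ * D + V ^ 2 / 2 + a * (1 - μ) / 2 * ξ ^ 2 + η ^ 2 / 2)
        + (W ^ 2 / 2 * (Θ * |e'|) + 4 * B ^ 2 / a * (Θ ^ 2 * R ^ 2 / (T * e))
          + (a ^ 2 / 2 + 3 * a / 4 + 1 / 2) / K * (R ^ 2 / κ)) := by
  obtain ⟨hμ1, hμ2⟩ := abs_le.1 hμ
  obtain ⟨hμ'1, hμ'2⟩ := abs_le.1 hμ'
  have hTe : 0 < T * e := mul_pos hT he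
  have hKκ : 0 < K * κ := mul_pos hK hκ
  have hδ0 : 0 < δ := by linarith
  -- Budget: i1 supplies a T / 2 of D and a T e / 4 of ξ². The former pays a T / 4 each for i2 and
  -- j1; the latter pays a T e / 16 each for i7 and i8 and a T e / 8 for j3. The U² and G² terms pay
  -- for V² in j2, and the η² term for j4.
  have i1 : a * (T / 2) * (D + e / 2 * ξ ^ 2) ≤ a * δ * I := by
    have : 0 ≤ D + e / 2 * ξ ^ 2 := by positivity
    gcongr
  have i2 : Θ' * D ≤ a * T / 4 * D := by gcongr
  have i3 : Θ * (e' / 2 * N) ≤ W ^ 2 / 2 * (Θ * |e'|) := by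
    rw [abs_of_nonpos he']
    have h := mul_le_mul_of_nonneg_left (mul_le_mul_of_nonneg_left hN (neg_nonneg.2 he')) hΘ
    linarith
  have i4 : P * (1 / 2) * U ^ 2 ≤ P * (1 - μ) * U ^ 2 := by gcongr; linarith
  have i5 : T / 2 * S * G ^ 2 ≤ δ * S * G ^ 2 := by gcongr
  have i6 : a * (T / 2) * e * η ^ 2 ≤ a * δ * e * η ^ 2 := by gcongr
  have i7 : -(a * μ' / 2 * ξ ^ 2) ≤ a * (T * e / 8) / 2 * ξ ^ 2 := by
    have : a * (-μ') / 2 * ξ ^ 2 ≤ a * (T * e / 8) / 2 * ξ ^ 2 := by gcongr; linarith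
    linarith
  have i8 : Θ * R * B * ξ ≤ a * (T * e) / 16 * ξ ^ 2 + 4 * B ^ 2 / a * (Θ ^ 2 * R ^ 2 / (T * e)) := by
    refine (mul_le_young (k := a * (T * e) / 8) (by positivity) _ _).trans (le_of_eq ?_)
    ring
  have i9 : a * R * V ≤ K * κ * (V ^ 2 / 2) + a ^ 2 / 2 / K * (R ^ 2 / κ) := by
    refine (mul_le_young hKκ _ _).trans (le_of_eq ?_)
    ring
  have i10 : a * (1 - μ) * R * ξ
      ≤ K * κ * (3 * a / 4) * ξ ^ 2 + 3 * a / 4 / K * (R ^ 2 / κ) := by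
    have h : a * (1 - μ) * R * ξ ≤ 3 / 2 * a * R * ξ := by
      have : a * (1 - μ) * R * ξ ≤ a * (3 / 2) * R * ξ := by gcongr; linarith
      linarith
    have h1 := mul_le_mul_of_nonneg_left (mul_le_young hKκ R ξ) (by positivity : 0 ≤ 3 / 2 * a)
    rw [← mul_assoc] at h1
    refine h.trans (h1.trans (le_of_eq ?_))
    ring
  have i11 : R * η ≤ K * κ * (η ^ 2 / 2) + 1 / 2 / K * (R ^ 2 / κ) := by
    refine (mul_le_young hKκ _ _).trans (le_of_eq ?_)
    ring
  have j1 : K * κ * (Θ * D) ≤ a * T / 4 * D := by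
    calc K * κ * (Θ * D) ≤ K * 1 * (C₃ * T * D) := by gcongr
      _ = K * C₃ * (T * D) := by ring
      _ ≤ a / 4 * (T * D) := by gcongr
      _ = _ := by ring
  have j2 : K * κ * V ^ 2 ≤ K * κ * (3 * a ^ 2) * ξ ^ 2 + P * (1 / 2) * U ^ 2
      + T / 2 * S * G ^ 2 := by
    have h1 : K * κ * (3 * (P ^ 2 * U ^ 2)) ≤ P * (1 / 2) * U ^ 2 := by
      calc K * κ * (3 * (P ^ 2 * U ^ 2)) = 3 * K * κ * P * (P * U ^ 2) := by ring
        _ ≤ 3 * K * 1 * k₁ * (P * U ^ 2) := by gcongr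
        _ = 3 * K * k₁ * (P * U ^ 2) := by ring
        _ ≤ 1 / 2 * (P * U ^ 2) := by gcongr
        _ = _ := by ring
    have h2 : K * κ * (3 * (S ^ 2 * G ^ 2)) ≤ T / 2 * S * G ^ 2 := by
      calc K * κ * (3 * (S ^ 2 * G ^ 2)) = 3 * K * κ * S * (S * G ^ 2) := by ring
        _ ≤ 3 * K * 1 * (C₂ * T) * (S * G ^ 2) := by gcongr
        _ = 3 * K * C₂ * (T * (S * G ^ 2)) := by ring
        _ ≤ 1 / 2 * (T * (S * G ^ 2)) := by gcongr
        _ = _ := by ring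
    have h3 := mul_le_mul_of_nonneg_left hV hKκ.le
    linarith
  have j3 : K * κ * (3 * a ^ 2 + 3 * a / 2) * ξ ^ 2 ≤ a * (T * e) / 8 * ξ ^ 2 := by
    have : K * κ * (3 * a ^ 2 + 3 * a / 2) ≤ a * (T * e) / 8 := by
      calc K * κ * (3 * a ^ 2 + 3 * a / 2)
          ≤ K * (C₁ * (T * e)) * (3 * a ^ 2 + 3 * a / 2) := by gcongr
        _ = K * C₁ * (3 * a ^ 2 + 3 * a / 2) * (T * e) := by ring
        _ ≤ a / 8 * (T * e) := by gcongr
        _ = _ := by ring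
    gcongr
  have j4 : K * κ * η ^ 2 ≤ a * (T / 2) * e * η ^ 2 := by
    have : K * κ ≤ a * (T / 2) * e := by
      calc K * κ ≤ K * (C₁ * (T * e)) := by gcongr
        _ = K * C₁ * (T * e) := by ring
        _ ≤ a / 2 * (T * e) := by gcongr
        _ = _ := by ring
    gcongr
  have j5 : K * κ * (a * (1 - μ) / 2 * ξ ^ 2) ≤ K * κ * (3 * a / 4) * ξ ^ 2 := by
    have : a * (1 - μ) ≤ a * (3 / 2) := by gcongr; linarith
    have : a * (1 - μ) / 2 ≤ 3 * a / 4 := by linarith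
    calc K * κ * (a * (1 - μ) / 2 * ξ ^ 2) ≤ K * κ * (3 * a / 4 * ξ ^ 2) := by gcongr
      _ = _ := by ring
  have e1 : (a ^ 2 / 2 + 3 * a / 4 + 1 / 2) / K * (R ^ 2 / κ)
      = a ^ 2 / 2 / K * (R ^ 2 / κ) + 3 * a / 4 / K * (R ^ 2 / κ) + 1 / 2 / K * (R ^ 2 / κ) := by
    ring
  rw [e1]
  linarith

/-- Because h decreases at relative rate at most K κ / 2, half of the decay rate of E remains to
absorb the source. For N large, E cannot cross N h at a contact point. Only right slopes of E are
needed, as the reference curve is merely Lipschitz. -/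
theorem exists_le_mul_of_slope_lt {E E' h h' κ : ℝ → ℝ} {T K C : ℝ} (hK : 0 < K)
    (hE : ContinuousOn E (Ici T))
    (hslope : ∀ t ∈ Ici T, ∀ r, E' t < r → ∃ᶠ z in 𝓝[>] t, slope E t z < r)
    (hE' : ∀ t ∈ Ici T, E' t ≤ -(K * κ t) * E t + C * (κ t * h t))
    (hκ : ∀ t ∈ Ici T, 0 < κ t) (hh : ∀ t ∈ Ici T, 0 < h t)
    (hd : ∀ t ∈ Ici T, HasDerivAt h (h' t) t)
    (hh' : ∀ t ∈ Ici T, -h' t ≤ K / 2 * (κ t * h t)) :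
    ∃ N, 0 < N ∧ ∀ t ∈ Ici T, E t ≤ N * h t := by
  have hT := hh T self_mem_Ici
  -- The three entries give the initial bound, 2 C < N K, and positivity; the added 1 makes the last
  -- two strict.
  set N := max (max (E T / h T) (2 * C / K)) 0 + 1 with hN
  have hN0 : 0 < N := by
    have := le_max_right (max (E T / h T) (2 * C / K)) 0
    linarith
  have hN1 : E T / h T ≤ N := by
    have := (le_max_left _ _).trans (le_max_left (max (E T / h T) (2 * C / K)) 0)
    linarith
  have hN2 : 2 * C / K < N := by
    have := (le_max_right _ _).trans (le_max_left (max (E T / h T) (2 * C / K)) 0)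
    linarith
  rw [div_lt_iff₀ hK] at hN2
  refine ⟨N, hN0, fun t ht => ?_⟩
  refine image_le_of_liminf_slope_right_lt_deriv_boundary' (f' := E') (B' := fun t => N * h' t)
    (hE.mono Icc_subset_Ici_self) (fun u hu => hslope u hu.1) ((div_le_iff₀ hT).1 hN1)
    (fun u hu => ((hd u hu.1).const_mul N).continuousAt.continuousWithinAt)
    (fun u hu => ((hd u hu.1).const_mul N).hasDerivWithinAt) ?_ (right_mem_Icc.2 ht)
  intro u hu heq
  have h1 := hE' u hu.1
  have h2 := mul_le_mul_of_nonneg_left (hh' u hu.1) hN0.le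
  have h3 : 0 < κ u * h u := mul_pos (hκ u hu.1) (hh u hu.1)
  have h4 := mul_lt_mul_of_pos_right hN2 h3
  rw [heq] at h1
  linarith

/-! ### Size and derivatives of the time-dependent coefficients. -/

section Coefficients

/-- The step size of the dual equation, up to the factor `α - 1`. -/
noncomputable def dualStep (γ q s t : ℝ) : ℝ := t ^ (q + s) - γ * q * t ^ (q - 1)

/-- The derivative of `t ^ q * m t`. -/
noncomputable def massRate (q t m₀ m₁ : ℝ) : ℝ := q * t ^ (q - 1) * m₀ + t ^ q * m₁

/-- The second derivative of `t ^ q * m t`. -/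
noncomputable def massRateDeriv (q t m₀ m₁ m₂ : ℝ) : ℝ :=
  q * (q - 1) * t ^ (q - 2) * m₀ + 2 * q * t ^ (q - 1) * m₁ + t ^ q * m₂

/-- The weight of the primal gap in the energy. -/
noncomputable def gapWeight (γ q s t m₀ m₁ : ℝ) : ℝ :=
  t ^ q * m₀ * dualStep γ q s t + γ * t ^ q * (1 - massRate q t m₀ m₁)

/-- The derivative of `gapWeight`. -/
noncomputable def gapWeightDeriv (γ q s t m₀ m₁ m₂ : ℝ) : ℝ :=
  massRate q t m₀ m₁ * dualStep γ q s t
    + t ^ q * m₀ * ((q + s) * t ^ (q + s - 1) - γ * q * ((q - 1) * t ^ (q - 2)))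
    + γ * (q * t ^ (q - 1)) * (1 - massRate q t m₀ m₁)
    - γ * t ^ q * massRateDeriv q t m₀ m₁ m₂

/-- The bounds on the mass and its first two derivatives at one time. -/
structure MassBoundsAt (γ q s k₁ k₂ t m₀ m₁ m₂ : ℝ) : Prop where
  pos : 0 < m₀
  lower : γ / t ^ (q + s) ≤ m₀
  upper : m₀ ≤ k₁ / t ^ q
  deriv : t * |m₁| ≤ k₂ * m₀
  deriv₂ : t ^ 2 * |m₂| ≤ k₂ * m₀

theorem hasDerivAt_rpow {t : ℝ} (ht : 0 < t) (q : ℝ) :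
    HasDerivAt (fun τ : ℝ => τ ^ q) (q * t ^ (q - 1)) t :=
  Real.hasDerivAt_rpow_const (Or.inl ht.ne')

variable {γ q s k₁ k₂ t m₀ m₁ m₂ : ℝ} {m m' : ℝ → ℝ}

theorem hasDerivAt_rpow_mul (ht : 0 < t) (hm : HasDerivAt m (m' t) t) :
    HasDerivAt (fun τ => τ ^ q * m τ) (massRate q t (m t) (m' t)) t :=
  (hasDerivAt_rpow ht q).mul hm

theorem hasDerivAt_massRate (ht : 0 < t) (hm : HasDerivAt m (m' t) t)
    (hm' : HasDerivAt m' m₂ t) :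
    HasDerivAt (fun τ => massRate q τ (m τ) (m' τ)) (massRateDeriv q t (m t) (m' t) m₂) t := by
  refine ((((hasDerivAt_rpow ht (q - 1)).const_mul q).mul hm).add
    ((hasDerivAt_rpow ht q).mul hm')).congr_deriv ?_
  rw [massRateDeriv, show q - 1 - 1 = q - 2 by ring]
  ring

theorem hasDerivAt_dualStep (ht : 0 < t) :
    HasDerivAt (dualStep γ q s)
      ((q + s) * t ^ (q + s - 1) - γ * q * ((q - 1) * t ^ (q - 2))) t := by
  refine ((hasDerivAt_rpow ht (q + s)).sub
    ((hasDerivAt_rpow ht (q - 1)).const_mul (γ * q))).congr_deriv ?_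
  rw [show q - 1 - 1 = q - 2 by ring]

theorem hasDerivAt_gapWeight (ht : 0 < t) (hm : HasDerivAt m (m' t) t)
    (hm' : HasDerivAt m' m₂ t) :
    HasDerivAt (fun τ => gapWeight γ q s τ (m τ) (m' τ))
      (gapWeightDeriv γ q s t (m t) (m' t) m₂) t := by
  refine (((hasDerivAt_rpow_mul (q := q) ht hm).mul (hasDerivAt_dualStep ht)).add
    (((hasDerivAt_rpow ht q).const_mul γ).mul
      ((hasDerivAt_massRate (q := q) ht hm hm').const_sub 1))).congr_deriv ?_
  rw [gapWeightDeriv]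
  ring

namespace MassBoundsAt

theorem rpow_mul_le (h : MassBoundsAt γ q s k₁ k₂ t m₀ m₁ m₂) (ht : 1 ≤ t) :
    t ^ q * m₀ ≤ k₁ := by
  have ht0 : 0 < t ^ q := Real.rpow_pos_of_pos (by linarith) q
  have := h.upper
  rw [le_div_iff₀ ht0] at this
  linarith

/-- The lower bound on the mass enters here: it makes the gradient part of the gap weight no larger
than its inertial part. -/
theorem gamma_mul_le (h : MassBoundsAt γ q s k₁ k₂ t m₀ m₁ m₂) (ht : 1 ≤ t) :
    γ * t ^ q ≤ t ^ q * m₀ * t ^ (q + s) := by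
  have ht0 : 0 < t ^ q := Real.rpow_pos_of_pos (by linarith) q
  have ht1 : 0 < t ^ (q + s) := Real.rpow_pos_of_pos (by linarith) (q + s)
  have := h.lower
  rw [div_le_iff₀ ht1] at this
  calc γ * t ^ q ≤ m₀ * t ^ (q + s) * t ^ q := by gcongr
    _ = _ := by ring

theorem abs_massRate_le (h : MassBoundsAt γ q s k₁ k₂ t m₀ m₁ m₂) (hq0 : 0 < q) (hk₂ : 0 < k₂)
    (ht : 1 ≤ t) : |massRate q t m₀ m₁| ≤ (q + k₂) * k₁ / t := by
  have ht0 : 0 < t := by linarith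
  have hQ : 0 < t ^ q := Real.rpow_pos_of_pos ht0 q
  have h1 := h.rpow_mul_le ht
  have hm := h.pos
  rw [massRate, Real.rpow_sub_one ht0.ne', le_div_iff₀ ht0]
  have h2 : |q * (t ^ q / t) * m₀ + t ^ q * m₁| ≤ q * (t ^ q / t) * m₀ + t ^ q * |m₁| := by
    refine (abs_add_le _ _).trans (le_of_eq ?_)
    rw [abs_mul (t ^ q), abs_of_pos hQ, abs_of_pos (by positivity)]
  calc _ ≤ (q * (t ^ q / t) * m₀ + t ^ q * |m₁|) * t := by gcongr
    _ = q * (t ^ q * m₀) + t ^ q * (t * |m₁|) := by field_simp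
    _ ≤ q * (t ^ q * m₀) + t ^ q * (k₂ * m₀) := by
      linarith [mul_le_mul_of_nonneg_left h.deriv hQ.le]
    _ = (q + k₂) * (t ^ q * m₀) := by ring
    _ ≤ _ := by gcongr

theorem abs_massRateDeriv_le (h : MassBoundsAt γ q s k₁ k₂ t m₀ m₁ m₂) (hq0 : 0 < q) (hq1 : q < 1)
    (hk₂ : 0 < k₂) (ht : 1 ≤ t) :
    |massRateDeriv q t m₀ m₁ m₂| ≤ (1 + 3 * k₂) * k₁ / t ^ 2 := by
  have ht0 : 0 < t := by linarith
  have hQ : 0 < t ^ q := Real.rpow_pos_of_pos ht0 q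
  have h1 := h.rpow_mul_le ht
  have hm := h.pos
  rw [massRateDeriv, Real.rpow_sub_one ht0.ne', show q - 2 = q - (2 : ℕ) by norm_num,
    Real.rpow_sub_natCast ht0.ne', le_div_iff₀ (by positivity)]
  have h2 : |q * (q - 1) * (t ^ q / t ^ 2) * m₀ + 2 * q * (t ^ q / t) * m₁ + t ^ q * m₂|
      ≤ 1 * (t ^ q / t ^ 2) * m₀ + 2 * (t ^ q / t) * |m₁| + t ^ q * |m₂| := by
    refine (abs_add_three _ _ _).trans ?_
    rw [abs_mul _ m₀, abs_mul (t ^ q), abs_of_pos hQ, abs_of_pos hm, abs_mul _ (t ^ q / t ^ 2),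
      abs_mul _ m₁, abs_of_pos (by positivity : 0 < t ^ q / t ^ 2),
      abs_of_pos (by positivity : 0 < 2 * q * (t ^ q / t))]
    have h3 : |q * (q - 1)| ≤ 1 := by
      rw [abs_le]
      constructor <;> nlinarith
    have h4 : 2 * q ≤ 2 := by linarith
    gcongr
  calc _ ≤ (1 * (t ^ q / t ^ 2) * m₀ + 2 * (t ^ q / t) * |m₁| + t ^ q * |m₂|) * t ^ 2 := by gcongr
    _ = t ^ q * m₀ + 2 * t ^ q * (t * |m₁|) + t ^ q * (t ^ 2 * |m₂|) := by field_simp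
    _ ≤ t ^ q * m₀ + 2 * t ^ q * (k₂ * m₀) + t ^ q * (k₂ * m₀) := by
      linarith [mul_le_mul_of_nonneg_left h.deriv hQ.le,
        mul_le_mul_of_nonneg_left h.deriv₂ hQ.le]
    _ = (1 + 3 * k₂) * (t ^ q * m₀) := by ring
    _ ≤ _ := by gcongr

end MassBoundsAt

theorem rpow_sub_one_le (hs : 0 < s) (ht : 1 ≤ t) : t ^ (q - 1) ≤ t ^ (q + s) / t := by
  rw [← Real.rpow_sub_one (by linarith)]
  exact Real.rpow_le_rpow_of_exponent_le ht (by linarith)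

theorem dualStep_le (hγ : 0 < γ) (hq0 : 0 < q) (ht : 1 ≤ t) :
    dualStep γ q s t ≤ t ^ (q + s) := by
  have : 0 < t ^ (q - 1) := Real.rpow_pos_of_pos (by linarith) _
  rw [dualStep, sub_le_self_iff]
  positivity

theorem half_rpow_le_dualStep (hγ : 0 < γ) (hq0 : 0 < q) (hs : 0 < s) (ht : 1 ≤ t)
    (htγ : 2 * γ * q ≤ t) : t ^ (q + s) / 2 ≤ dualStep γ q s t := by
  have ht0 : 0 < t := by linarith
  have hT : 0 < t ^ (q + s) := Real.rpow_pos_of_pos ht0 _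
  have h1 : γ * q * t ^ (q - 1) ≤ t ^ (q + s) / 2 := by
    calc γ * q * t ^ (q - 1) ≤ γ * q * (t ^ (q + s) / t) := by
          gcongr
          exact rpow_sub_one_le hs ht
      _ = (2 * γ * q) * (t ^ (q + s) / t) / 2 := by ring
      _ ≤ t * (t ^ (q + s) / t) / 2 := by gcongr
      _ = _ := by field_simp
  rw [dualStep]
  linarith

namespace MassBoundsAt

theorem gapWeight_nonneg (h : MassBoundsAt γ q s k₁ k₂ t m₀ m₁ m₂) (hγ : 0 < γ)
    (ht : 1 ≤ t) (hδ : 0 ≤ dualStep γ q s t) (hμ : |massRate q t m₀ m₁| ≤ 1 / 2) :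
    0 ≤ gapWeight γ q s t m₀ m₁ := by
  have hQ : 0 < t ^ q := Real.rpow_pos_of_pos (by linarith) q
  have hm := h.pos
  have : 0 ≤ 1 - massRate q t m₀ m₁ := by linarith [(abs_le.1 hμ).2]
  rw [gapWeight]
  positivity

theorem gapWeight_le (h : MassBoundsAt γ q s k₁ k₂ t m₀ m₁ m₂) (hγ : 0 < γ) (hq0 : 0 < q)
    (ht : 1 ≤ t) (hμ : |massRate q t m₀ m₁| ≤ 1 / 2) :
    gapWeight γ q s t m₀ m₁ ≤ 5 / 2 * (t ^ q * m₀ * t ^ (q + s)) := by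
  have hQ : 0 < t ^ q := Real.rpow_pos_of_pos (by linarith) q
  have hm := h.pos
  have h1 : 1 - massRate q t m₀ m₁ ≤ 3 / 2 := by linarith [(abs_le.1 hμ).1]
  calc gapWeight γ q s t m₀ m₁
      ≤ t ^ q * m₀ * t ^ (q + s) + γ * t ^ q * (3 / 2) := by
        rw [gapWeight]
        gcongr
        exact dualStep_le hγ hq0 ht
    _ ≤ _ := by linarith [h.gamma_mul_le ht]

/-- Each term loses a factor t against t ^ (q + s), so for large t the growth of the gap weight is a
small part of the dissipation of the gap. -/
theorem gapWeightDeriv_le (h : MassBoundsAt γ q s k₁ k₂ t m₀ m₁ m₂) (hγ : 0 < γ) (hq0 : 0 < q)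
    (hq1 : q < 1) (hs : 0 < s) (hk₂ : 0 < k₂) (ht : 1 ≤ t)
    (hδ : 0 ≤ dualStep γ q s t) (hμ : |massRate q t m₀ m₁| ≤ 1 / 2) :
    gapWeightDeriv γ q s t m₀ m₁ m₂
      ≤ ((q + k₂) * k₁ + k₁ * (q + s + γ) + 2 * γ + γ * ((1 + 3 * k₂) * k₁))
        * (t ^ (q + s) / t) := by
  have ht0 : 0 < t := by linarith
  have hQ : 0 < t ^ q := Real.rpow_pos_of_pos ht0 q
  have hT : 0 < t ^ (q + s) := Real.rpow_pos_of_pos ht0 _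
  have hQT : t ^ q ≤ t ^ (q + s) := Real.rpow_le_rpow_of_exponent_le ht (by linarith)
  have hm := h.pos
  have hP := h.rpow_mul_le ht
  have hk₁ : 0 < k₁ := lt_of_lt_of_le (by positivity) hP
  have h1 : massRate q t m₀ m₁ * dualStep γ q s t ≤ (q + k₂) * k₁ * (t ^ (q + s) / t) := by
    calc massRate q t m₀ m₁ * dualStep γ q s t
        ≤ |massRate q t m₀ m₁| * dualStep γ q s t := by gcongr; exact le_abs_self _
      _ ≤ (q + k₂) * k₁ / t * t ^ (q + s) := by
        gcongr
        · exact h.abs_massRate_le hq0 hk₂ ht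
        · exact dualStep_le hγ hq0 ht
      _ = _ := by ring
  have h2 : (q + s) * t ^ (q + s - 1) - γ * q * ((q - 1) * t ^ (q - 2))
      ≤ (q + s + γ) * (t ^ (q + s) / t) := by
    have h3 : t ^ (q - 2) ≤ t ^ (q + s) / t := by
      rw [← Real.rpow_sub_one ht0.ne']
      exact Real.rpow_le_rpow_of_exponent_le ht (by linarith)
    have h4 : γ * (q * (1 - q)) * t ^ (q - 2) ≤ γ * 1 * (t ^ (q + s) / t) := by
      have : q * (1 - q) ≤ 1 := by nlinarith
      gcongr
    rw [Real.rpow_sub_one ht0.ne']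
    linarith
  have h5 : t ^ q * m₀ * ((q + s) * t ^ (q + s - 1) - γ * q * ((q - 1) * t ^ (q - 2)))
      ≤ k₁ * ((q + s + γ) * (t ^ (q + s) / t)) := by
    calc _ ≤ t ^ q * m₀ * ((q + s + γ) * (t ^ (q + s) / t)) := by gcongr
      _ ≤ _ := by gcongr
  have h6 : γ * (q * t ^ (q - 1)) * (1 - massRate q t m₀ m₁)
      ≤ 2 * γ * (t ^ (q + s) / t) := by
    calc _ ≤ γ * (1 * (t ^ (q + s) / t)) * 2 := by
          have : 1 - massRate q t m₀ m₁ ≤ 2 := by linarith [(abs_le.1 hμ).1]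
          have : t ^ (q - 1) ≤ t ^ (q + s) / t := rpow_sub_one_le hs ht
          have := Real.rpow_pos_of_pos ht0 (q - 1)
          have : 0 ≤ 1 - massRate q t m₀ m₁ := by linarith [(abs_le.1 hμ).2]
          gcongr
      _ = _ := by ring
  have h7 : -(γ * t ^ q * massRateDeriv q t m₀ m₁ m₂)
      ≤ γ * ((1 + 3 * k₂) * k₁) * (t ^ (q + s) / t) := by
    calc _ = γ * t ^ q * -massRateDeriv q t m₀ m₁ m₂ := by ring
      _ ≤ γ * t ^ (q + s) * ((1 + 3 * k₂) * k₁ / t ^ 2) := by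
        have h8 := (neg_le_abs _).trans (h.abs_massRateDeriv_le hq0 hq1 hk₂ ht)
        refine (mul_le_mul_of_nonneg_left h8 (by positivity)).trans ?_
        gcongr
      _ ≤ γ * t ^ (q + s) * ((1 + 3 * k₂) * k₁ / t) := by
        gcongr
        exact le_self_pow₀ ht two_ne_zero
      _ = _ := by ring
  rw [gapWeightDeriv]
  linarith

end MassBoundsAt

end Coefficients

/-! ### Differential inequality and coercivity of the energy. -/

section EnergyDecay

variable {X Y : Type*} [NormedAddCommGroup X] [InnerProductSpace ℝ X]
  [NormedAddCommGroup Y] [InnerProductSpace ℝ Y]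
  {f : X → ℝ} {A : X →L[ℝ] Y} {b : Y}

/-- The upper right derivative of the energy along moving regularized saddle points. -/
theorem eventually_slope_energy_lt {a d R W t : ℝ} {ε Θ μ : ℝ → ℝ} {x y : ℝ → X} {l : ℝ → Y}
    {zt : ℝ → WithLp 2 (X × Y)} (ha : 0 ≤ a)
    (hF : HasDerivAt (fun τ =>
      energy f A b a (ε τ) (Θ τ) (μ τ) (x τ) (y τ) (l τ) (zt t).fst (zt t).snd) d t)
    (hε : ContinuousAt ε t) (hΘ : ContinuousAt Θ t) (hμ : ContinuousAt μ t)
    (hx : ContinuousAt x t) (hy : ContinuousAt y t) (hl : ContinuousAt l t)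
    (hε0 : ∀ τ, t ≤ τ → 0 ≤ ε τ) (hΘ0 : ∀ τ, t ≤ τ → 0 ≤ Θ τ) (hμ1 : ∀ τ, t ≤ τ → μ τ ≤ 1)
    (hzt : ∀ τ, t ≤ τ → IsSaddlePt (tikhonovLagrangian f A b (ε τ)) (zt τ))
    (hlip : ∀ τ, t ≤ τ → ‖zt τ - zt t‖ ≤ R * (τ - t)) (hW : ∀ τ, t ≤ τ → ‖zt τ‖ ≤ W)
    {r : ℝ} (hr : d + (Θ t * R * ‖A (x t) - b - ε t • (zt t).snd‖
      + a * R * ‖a • (x t - (zt t).fst) + y t‖ + a * (1 - μ t) * R * ‖x t - (zt t).fst‖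
      + R * ‖l t - (zt t).snd‖) < r) :
    ∀ᶠ τ in 𝓝[>] t, slope (fun τ =>
      energy f A b a (ε τ) (Θ τ) (μ τ) (x τ) (y τ) (l τ) (zt τ).fst (zt τ).snd) t τ < r := by
  let g : ℝ → ℝ := fun τ =>
    Θ τ * (R * ‖A (x τ) - b - ε τ • (zt t).snd‖ + |ε τ - ε t| * W * R)
      + (a * R * ‖a • (x τ - (zt t).fst) + y τ‖ + a ^ 2 * R ^ 2 / 2 * (τ - t))
      + a * (1 - μ τ) / 2 * (2 * R * ‖x τ - (zt t).fst‖ + R ^ 2 * (τ - t))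
      + (R * ‖l τ - (zt t).snd‖ + R ^ 2 / 2 * (τ - t))
  have hAx : ContinuousAt (fun τ => A (x τ)) t := A.continuous.continuousAt.comp hx
  have hg : ContinuousAt g t := by fun_prop
  refine eventually_slope_lt hF hg rfl ?_ ?_
  · filter_upwards [self_mem_nhdsWithin] with τ hτ
    have hτ' : t ≤ τ := le_of_lt hτ
    refine (energy_le_energy_add ha (hε0 τ hτ') (hΘ0 τ hτ') (hμ1 τ hτ') (hzt t le_rfl)
      (hzt τ hτ') (hlip τ hτ') (hW t le_rfl) (hW τ hτ')).trans (le_of_eq ?_)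
    simp only [g]
    ring
  · refine lt_of_eq_of_lt ?_ hr
    simp only [g, sub_self, abs_zero]
    ring

/-- The decay estimate of the energy relative to a fixed saddle point. -/
theorem energy_rate_le [CompleteSpace X] [CompleteSpace Y]
    (hconv : ConvexOn ℝ univ f) (hd : Differentiable ℝ f)
    {a T e κ δ P S Θ Θ' μ μ' e' R W K k₁ C₁ C₂ C₃ : ℝ} {x y u G : X} {l : Y} {z : WithLp 2 (X × Y)}
    (ha : 0 < a) (hT : 0 < T) (he : 0 < e) (hκ : 0 < κ) (hκ1 : κ ≤ 1) (hκe : κ ≤ C₁ * (T * e))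
    (hδ : T / 2 ≤ δ) (hP : 0 ≤ P) (hPk : P ≤ k₁) (hS : 0 ≤ S) (hSC : S ≤ C₂ * T)
    (hΘ : 0 ≤ Θ) (hΘC : Θ ≤ C₃ * T) (hΘ' : Θ' ≤ a * T / 4) (hμ : |μ| ≤ 1 / 2)
    (hμ' : |μ'| ≤ T * e / 8) (he' : e' ≤ 0) (hR : 0 ≤ R)
    (hK : 0 < K) (hK1 : K * C₃ ≤ a / 4) (hK2 : K * C₁ * (3 * a ^ 2 + 3 * a / 2) ≤ a / 8)
    (hK3 : 3 * K * k₁ ≤ 1 / 2) (hK4 : 3 * K * C₂ ≤ 1 / 2) (hK5 : K * C₁ ≤ a / 2)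
    (hz : IsKKTPair f A b e z.fst z.snd) (hzW : ‖z‖ ≤ W) (hy : y = P • u + S • G) :
    (Θ' * (tikhonovLagrangian f A b e x z.snd - tikhonovLagrangian f A b e z.fst z.snd)
        + Θ * (e' / 2 * (‖x‖ ^ 2 - ‖z.fst‖ ^ 2))
        - a * δ * inner ℝ (gradient f x + A.adjoint z.snd + e • x) (x - z.fst)
        - P * (1 - μ) * ‖u‖ ^ 2 - δ * S * ‖G‖ ^ 2 - a * δ * e * ‖l - z.snd‖ ^ 2
        - a * μ' / 2 * ‖x - z.fst‖ ^ 2)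
      + (Θ * R * ‖A x - b - e • z.snd‖
      + a * R * ‖a • (x - z.fst) + y‖ + a * (1 - μ) * R * ‖x - z.fst‖ + R * ‖l - z.snd‖)
      ≤ -(K * κ) * energy f A b a e Θ μ x y l z.fst z.snd
        + (W ^ 2 / 2 * (Θ * |e'|) + 4 * ‖A‖ ^ 2 / a * (Θ ^ 2 * R ^ 2 / (T * e))
          + (a ^ 2 / 2 + 3 * a / 4 + 1 / 2) / K * (R ^ 2 / κ)) := by
  have hD := ((isSaddlePt_tikhonovLagrangian_iff hconv hd he.le).2 hz x z.snd).2
  have hI := tikhonovLagrangian_add_inner_le (A := A) (b := b) hconv hd e x z.fst z.snd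
  rw [← neg_sub x z.fst, inner_neg_right, norm_neg] at hI
  have hN : -W ^ 2 ≤ ‖x‖ ^ 2 - ‖z.fst‖ ^ 2 := by
    have h1 : ‖z.fst‖ ≤ W := (WithLp.norm_fst_le ..).trans hzW
    have h2 : ‖z.fst‖ ^ 2 ≤ W ^ 2 := by gcongr
    nlinarith [sq_nonneg ‖x‖]
  have hA : ‖A x - b - e • z.snd‖ ≤ ‖A‖ * ‖x - z.fst‖ := by
    rw [← hz.dual, sub_sub_sub_cancel_right, ← map_sub]
    exact A.le_opNorm _
  have hV : ‖a • (x - z.fst) + y‖ ^ 2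
      ≤ 3 * (a ^ 2 * ‖x - z.fst‖ ^ 2 + P ^ 2 * ‖u‖ ^ 2 + S ^ 2 * ‖G‖ ^ 2) := by
    have h1 : ‖a • (x - z.fst) + y‖ ≤ a * ‖x - z.fst‖ + P * ‖u‖ + S * ‖G‖ := by
      have h2 := norm_add₃_le (a := a • (x - z.fst)) (b := P • u) (c := S • G)
      rwa [norm_smul, norm_smul, norm_smul, Real.norm_of_nonneg ha.le, Real.norm_of_nonneg hP,
        Real.norm_of_nonneg hS, add_assoc, ← hy] at h2
    have h3 : ‖a • (x - z.fst) + y‖ ^ 2 ≤ (a * ‖x - z.fst‖ + P * ‖u‖ + S * ‖G‖) ^ 2 := by gcongr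
    nlinarith [sq_nonneg (a * ‖x - z.fst‖ - P * ‖u‖), sq_nonneg (a * ‖x - z.fst‖ - S * ‖G‖),
      sq_nonneg (P * ‖u‖ - S * ‖G‖)]
  have main := dissipation_le (W := W) (U := ‖u‖) (G := ‖G‖) (η := ‖l - z.snd‖) (B := ‖A‖)
    (N := ‖x‖ ^ 2 - ‖z.fst‖ ^ 2) (ξ := ‖x - z.fst‖) (V := ‖a • (x - z.fst) + y‖)
    (D := tikhonovLagrangian f A b e x z.snd - tikhonovLagrangian f A b e z.fst z.snd)
    (I := inner ℝ (gradient f x + A.adjoint z.snd + e • x) (x - z.fst))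
    ha hT he hκ hκ1 hκe hδ hP hPk hS hSC hΘ hΘC hΘ' hμ hμ' he' hR hK hK1 hK2 hK3 hK4 hK5
    (sub_nonneg.2 hD) (by linarith) hN (norm_nonneg _) hV
  have h4 := mul_le_mul_of_nonneg_left hA (mul_nonneg hΘ hR)
  rw [energy]
  linarith

/-- The gap is nonnegative at a saddle point and 1 - μ ≥ 1 / 2, so the two quadratic terms alone
control both components. -/
theorem norm_sq_le_energy [CompleteSpace X] [CompleteSpace Y]
    (hconv : ConvexOn ℝ univ f) (hd : Differentiable ℝ f) {a e Θ μ : ℝ} {x y : X} {l : Y}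
    {z : WithLp 2 (X × Y)} (ha : 0 < a) (he : 0 ≤ e) (hΘ : 0 ≤ Θ) (hμ : |μ| ≤ 1 / 2)
    (hz : IsKKTPair f A b e z.fst z.snd) :
    ‖WithLp.toLp 2 (x, l) - z‖ ^ 2
      ≤ (4 / a + 2) * energy f A b a e Θ μ x y l z.fst z.snd := by
  have hD := mul_nonneg hΘ (sub_nonneg.2
    ((isSaddlePt_tikhonovLagrangian_iff hconv hd he).2 hz x z.snd).2)
  have h1 : 1 / 2 ≤ 1 - μ := by linarith [(abs_le.1 hμ).2]
  have h2 : a * (1 / 2) / 2 * ‖x - z.fst‖ ^ 2 ≤ a * (1 - μ) / 2 * ‖x - z.fst‖ ^ 2 := by gcongr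
  have h3 : 0 ≤ ‖a • (x - z.fst) + y‖ ^ 2 := by positivity
  have h4 : 0 ≤ a * (1 / 2) / 2 * ‖x - z.fst‖ ^ 2 := by positivity
  have h5 : 0 ≤ ‖l - z.snd‖ ^ 2 := by positivity
  rw [WithLp.prod_norm_sq_eq_of_L2]
  change ‖x - z.fst‖ ^ 2 + ‖l - z.snd‖ ^ 2 ≤ _
  set E := energy f A b a e Θ μ x y l z.fst z.snd with hE
  have h6 : a / 4 * ‖x - z.fst‖ ^ 2 ≤ E := by rw [hE, energy]; linarith
  have h7 : ‖l - z.snd‖ ^ 2 ≤ 2 * E := by rw [hE, energy]; linarith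
  have h8 : ‖x - z.fst‖ ^ 2 ≤ 4 / a * E := by
    calc ‖x - z.fst‖ ^ 2 = 4 / a * (a / 4 * ‖x - z.fst‖ ^ 2) := by field_simp
      _ ≤ _ := by gcongr
  linarith

end EnergyDecay

/-! ### Source terms of the differential inequality and asymptotic smallness. -/

section Sources

variable {γ q s k₁ k₂ t m₀ m₁ m₂ : ℝ}

theorem hasDerivAt_const_div_rpow {t : ℝ} (ht : 0 < t) (c p : ℝ) :
    HasDerivAt (fun τ : ℝ => c / τ ^ p) (-(p * (c / t ^ p) / t)) t := by
  have h0 := (Real.rpow_pos_of_pos ht p).ne'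
  refine ((hasDerivAt_const t c).div (hasDerivAt_rpow ht p) h0).congr_deriv ?_
  rw [Real.rpow_sub_one ht.ne']
  field_simp
  ring

/-- The three sources come from the drift of c / t ^ p, the motion of the reference point seen by
the gap, and its motion seen by the quadratic terms. After cancelling r, the common majorant is t ^
q * m₀ * t ^ (q + s) * t ^ σ; the third source has no factor m₀ and is compared with it through
`gamma_mul_le`. -/
theorem MassBoundsAt.source_le (h : MassBoundsAt γ q s k₁ k₂ t m₀ m₁ m₂) (hγ : 0 < γ)
    {c p r σ W B₁ B₂ Θ : ℝ} (ht : 1 ≤ t) (hc : 0 < c) (hp0 : 0 < p)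
    (hσ1 : q + p - 2 ≤ σ) (hσ2 : -p - 1 ≤ σ) (hq0 : 0 < q) (hr : r - 2 ≤ q + σ)
    (hB₁ : 0 ≤ B₁) (hB₂ : 0 ≤ B₂) (hΘ0 : 0 ≤ Θ) (hΘ : Θ ≤ 5 / 2 * (t ^ q * m₀ * t ^ (q + s))) :
    W ^ 2 / 2 * (Θ * |-(p * (c / t ^ p) / t)|)
      + B₁ * (Θ ^ 2 * (W / t) ^ 2 / (t ^ (q + s) * (c / t ^ p))) + B₂ * ((W / t) ^ 2 / t ^ (-r))
      ≤ (W ^ 2 / 2 * (5 / 2 * p * c) + B₁ * (25 / 4 * k₁ * W ^ 2 / c) + B₂ * (W ^ 2 / γ))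
        * (t ^ (-r) * (m₀ * t ^ (2 * q + s + σ + r))) := by
  have ht0 : 0 < t := by linarith
  have hm := h.pos
  have hQ : 0 < t ^ q := Real.rpow_pos_of_pos ht0 q
  have hT : 0 < t ^ (q + s) := Real.rpow_pos_of_pos ht0 _
  have hp' : 0 < t ^ p := Real.rpow_pos_of_pos ht0 _
  have hσ' : 0 < t ^ σ := Real.rpow_pos_of_pos ht0 _
  have hr' : 0 < t ^ r := Real.rpow_pos_of_pos ht0 _
  have hP := h.rpow_mul_le ht
  have hγP := h.gamma_mul_le ht
  have e0 : t ^ (-r) * (m₀ * t ^ (2 * q + s + σ + r)) = t ^ q * m₀ * t ^ (q + s) * t ^ σ := by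
    rw [show 2 * q + s + σ + r = q + (q + s) + σ + r by ring, Real.rpow_add ht0 _ r,
      Real.rpow_add ht0 _ σ, Real.rpow_add ht0 q (q + s), Real.rpow_neg ht0.le]
    field_simp
  rw [e0]
  set F := t ^ q * m₀ * t ^ (q + s) with hF
  have hF0 : 0 < F := by positivity
  have p1 : (t ^ p)⁻¹ / t ≤ t ^ σ := by
    rw [← Real.rpow_neg ht0.le, ← Real.rpow_sub_one ht0.ne']
    exact Real.rpow_le_rpow_of_exponent_le ht hσ2
  have p2 : t ^ p / t ^ 2 ≤ t ^ σ := by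
    rw [← Real.rpow_sub_natCast ht0.ne']
    refine Real.rpow_le_rpow_of_exponent_le ht ?_
    push_cast
    linarith
  have p3 : t ^ r / t ^ 2 ≤ t ^ q * t ^ σ := by
    rw [← Real.rpow_sub_natCast ht0.ne', ← Real.rpow_add ht0]
    refine Real.rpow_le_rpow_of_exponent_le ht ?_
    push_cast
    linarith
  have s1 : Θ * |-(p * (c / t ^ p) / t)| ≤ 5 / 2 * p * c * (F * t ^ σ) := by
    rw [abs_neg, abs_of_pos (by positivity)]
    calc Θ * (p * (c / t ^ p) / t) ≤ 5 / 2 * F * (p * (c / t ^ p) / t) := by gcongr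
      _ = 5 / 2 * p * c * (F * ((t ^ p)⁻¹ / t)) := by ring
      _ ≤ _ := by gcongr
  have s2 : Θ ^ 2 * (W / t) ^ 2 / (t ^ (q + s) * (c / t ^ p))
      ≤ 25 / 4 * k₁ * W ^ 2 / c * (F * t ^ σ) := by
    have h1 : Θ ^ 2 ≤ 25 / 4 * (k₁ * t ^ (q + s)) * F := by
      calc Θ ^ 2 ≤ (5 / 2 * F) ^ 2 := by gcongr
        _ = 25 / 4 * (t ^ q * m₀ * t ^ (q + s)) * F := by ring
        _ ≤ _ := by gcongr
    have hk₁ : 0 < k₁ := lt_of_lt_of_le (by positivity) hP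
    calc Θ ^ 2 * (W / t) ^ 2 / (t ^ (q + s) * (c / t ^ p))
        ≤ 25 / 4 * (k₁ * t ^ (q + s)) * F * (W / t) ^ 2 / (t ^ (q + s) * (c / t ^ p)) := by gcongr
      _ = 25 / 4 * k₁ * W ^ 2 / c * (F * (t ^ p / t ^ 2)) := by field_simp
      _ ≤ _ := by gcongr
  have s3 : (W / t) ^ 2 / t ^ (-r) ≤ W ^ 2 / γ * (F * t ^ σ) := by
    rw [Real.rpow_neg ht0.le]
    calc (W / t) ^ 2 / (t ^ r)⁻¹ = W ^ 2 * (t ^ r / t ^ 2) := by field_simp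
      _ ≤ W ^ 2 * (t ^ q * t ^ σ) := by gcongr
      _ = W ^ 2 / γ * (γ * t ^ q * t ^ σ) := by field_simp
      _ ≤ _ := by gcongr
  have s1' := mul_le_mul_of_nonneg_left s1 (by positivity : 0 ≤ W ^ 2 / 2)
  have s2' := mul_le_mul_of_nonneg_left s2 hB₁
  have s3' := mul_le_mul_of_nonneg_left s3 hB₂
  linarith

theorem neg_mul_rpow_deriv_le {t ρ k₂ m₀ m₁ : ℝ} (ht : 0 < t) (hm : 0 < m₀)
    (h : t * |m₁| ≤ k₂ * m₀) :
    -(m₁ * t ^ ρ + m₀ * (ρ * t ^ (ρ - 1))) ≤ (k₂ + |ρ|) / t * (m₀ * t ^ ρ) := by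
  have hρ : 0 < t ^ ρ := Real.rpow_pos_of_pos ht _
  rw [Real.rpow_sub_one ht.ne']
  have h1 : -m₁ * t ^ ρ ≤ k₂ / t * (m₀ * t ^ ρ) := by
    calc -m₁ * t ^ ρ ≤ |m₁| * t ^ ρ := by gcongr; exact neg_le_abs m₁
      _ = t * |m₁| * (t ^ ρ / t) := by field_simp
      _ ≤ k₂ * m₀ * (t ^ ρ / t) := by gcongr
      _ = _ := by ring
  have h2 : -ρ * (m₀ * (t ^ ρ / t)) ≤ |ρ| * (m₀ * (t ^ ρ / t)) := by
    gcongr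
    exact neg_le_abs ρ
  have h3 : (k₂ + |ρ|) / t * (m₀ * t ^ ρ)
    = k₂ / t * (m₀ * t ^ ρ) + |ρ| * (m₀ * (t ^ ρ / t)) := by ring
  rw [h3]
  linarith

theorem eventually_mul_le_nhdsGT {d : ℝ} (hd : 0 < d) (k : ℝ) :
    ∀ᶠ K : ℝ in 𝓝[>] 0, K * k ≤ d := by
  have h : Tendsto (fun K : ℝ => K * k) (𝓝[>] 0) (𝓝 0) := by
    have : Tendsto (fun K : ℝ => K * k) (𝓝 0) (𝓝 (0 * k)) := tendsto_id.mul_const k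
    rw [zero_mul] at this
    exact this.mono_left nhdsWithin_le_nhds
  exact h.eventually_le_const hd

theorem eventually_div_le_atTop {d : ℝ} (hd : 0 < d) (k : ℝ) : ∀ᶠ t : ℝ in atTop, k / t ≤ d :=
  (tendsto_const_nhds.div_atTop tendsto_id).eventually_le_const hd

theorem eventually_div_le_rpow_neg {d r : ℝ} (hd : 0 < d) (hr : r < 1) (k : ℝ) :
    ∀ᶠ t : ℝ in atTop, k / t ≤ d * t ^ (-r) := by
  have h : Tendsto (fun t : ℝ => k * t ^ (-(1 - r))) atTop (𝓝 0) := by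
    simpa using (tendsto_rpow_neg_atTop (sub_pos.2 hr)).const_mul k
  filter_upwards [h.eventually_le_const hd, eventually_gt_atTop 0] with t h1 ht
  have h2 : k / t = k * t ^ (-(1 - r)) * t ^ (-r) := by
    rw [mul_assoc, ← Real.rpow_add ht, show -(1 - r) + -r = -1 by ring, Real.rpow_neg_one]
    rfl
  rw [h2]
  have := Real.rpow_pos_of_pos ht (-r)
  gcongr

end Sources

/-! ### From the differential system to the energy estimate. -/

section System

variable {X Y : Type*} [NormedAddCommGroup X] [InnerProductSpace ℝ X]
  [NormedAddCommGroup Y] [InnerProductSpace ℝ Y]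
  {f : X → ℝ} {A : X →L[ℝ] Y} {b : Y}

theorem gradDual_eq [CompleteSpace Y] (f : X → ℝ) (A : X →L[ℝ] Y) (b : Y) (c p t : ℝ) (x : X) (l : Y) :
    gradDual f A b c p t x l = A x - b - (c / t ^ p) • l := by
  rw [gradDual, regLagrangian_eq]
  exact (hasGradientAt_tikhonovLagrangian_dual _ x l).gradient

theorem continuousOn_energy {S : Set ℝ} (hf : Continuous f) {a : ℝ} {ε Θ μ : ℝ → ℝ} {x y : ℝ → X}
    {l : ℝ → Y} {z : ℝ → WithLp 2 (X × Y)} (hε : ContinuousOn ε S) (hΘ : ContinuousOn Θ S)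
    (hμ : ContinuousOn μ S) (hx : ContinuousOn x S) (hy : ContinuousOn y S)
    (hl : ContinuousOn l S) (hz : ContinuousOn z S) :
    ContinuousOn (fun τ =>
      energy f A b a (ε τ) (Θ τ) (μ τ) (x τ) (y τ) (l τ) (z τ).fst (z τ).snd) S := by
  have hz' : ContinuousOn (fun τ => WithLp.ofLp (z τ)) S :=
    (WithLp.prod_continuous_ofLp 2 X Y).comp_continuousOn hz
  have hz1 : ContinuousOn (fun τ => (z τ).fst) S := hz'.fst
  have hz2 : ContinuousOn (fun τ => (z τ).snd) S := hz'.snd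
  have hfx : ContinuousOn (fun τ => f (x τ)) S := hf.comp_continuousOn hx
  have hfz : ContinuousOn (fun τ => f (z τ).fst) S := hf.comp_continuousOn hz1
  have hAx : ContinuousOn (fun τ => A (x τ)) S := A.continuous.comp_continuousOn hx
  have hAz : ContinuousOn (fun τ => A (z τ).fst) S := A.continuous.comp_continuousOn hz1
  simp only [energy, tikhonovLagrangian, lagrangian]
  fun_prop

end System

section System

variable {X Y : Type*} [NormedAddCommGroup X] [InnerProductSpace ℝ X] [CompleteSpace X]
  [NormedAddCommGroup Y] [InnerProductSpace ℝ Y] [CompleteSpace Y]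
  {f : X → ℝ} {A : X →L[ℝ] Y} {b : Y} {α γ c p q s t₀ : ℝ} {m : ℝ → ℝ} {x : ℝ → X} {l : ℝ → Y}

theorem gradPrimal_eq (hd : Differentiable ℝ f) (c p t : ℝ) (x : X) (l : Y) :
    gradPrimal f A b c p t x l = gradient f x + A.adjoint l + (c / t ^ p) • x := by
  rw [gradPrimal, regLagrangian_eq]
  exact (hasGradientAt_tikhonovLagrangian_primal hd _ x l).gradient

/-- This is the identity behind the formula for θ: it turns the extrapolated dual equation into one
whose A x' coefficient is the gap weight. -/
theorem mul_extrapolation {t : ℝ} (hα : 1 < α) (ht : 0 < t) (hδ : dualStep γ q s t ≠ 0) :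
    (α - 1) * dualStep γ q s t * extrapolation α γ q s t₀ m t
      = gapWeight γ q s t (m t) (derivWithin m (Ici t₀) t) := by
  have hα' : α - 1 ≠ 0 := (sub_pos.2 hα).ne'
  have h : (α - 1) * (t ^ (q + s) - γ * q * t ^ (q - 1)) ≠ 0 := mul_ne_zero hα' hδ
  have e1 : t ^ (2 * q + s) = t ^ q * t ^ (q + s) := by
    rw [← Real.rpow_add ht]; congr 1; ring
  have e2 : t ^ (2 * q - 1) = t ^ q * t ^ (q - 1) := by
    rw [← Real.rpow_add ht]; congr 1; ring
  have e3 : t ^ (2 * q) = t ^ q * t ^ q := by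
    rw [← Real.rpow_add ht]; congr 1; ring
  rw [extrapolation, gapWeight, massRate, dualStep, mul_div_cancel₀ _ h, e1, e2, e3]
  ring

theorem hasDerivAt_of_differentiableOn_Ici {E : Type*} [NormedAddCommGroup E] [NormedSpace ℝ E]
    {g : ℝ → E} {t₀ t : ℝ} (hg : DifferentiableOn ℝ g (Ici t₀)) (ht : t₀ < t) :
    HasDerivAt g (derivWithin g (Ici t₀) t) t :=
  (hg t ht.le).hasDerivWithinAt.hasDerivAt (Ici_mem_nhds ht)

namespace IsGlobalSolution

/-- The momentum `t ^ q * m t * x' t + γ * t ^ q * ∇ₓ L_t(x t, l t)`. -/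
noncomputable def momentum (f : X → ℝ) (A : X →L[ℝ] Y) (b : Y) (γ c p q t₀ : ℝ) (m : ℝ → ℝ) (x : ℝ → X)
    (l : ℝ → Y) (t : ℝ) : X :=
  (t ^ q * m t) • derivWithin x (Ici t₀) t + (γ * t ^ q) • gradPrimal f A b c p t (x t) (l t)

theorem hasDerivAt_momentum (hsol : IsGlobalSolution f A b α γ c p q s t₀ m x l)
    (hm : IsMass t₀ m) (ht₀ : 0 < t₀) {t : ℝ} (ht : t₀ < t) :
    HasDerivAt (momentum f A b γ c p q t₀ m x l)
      (-(α - 1 + 1 - massRate q t (m t) (derivWithin m (Ici t₀) t)) • derivWithin x (Ici t₀) t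
        - dualStep γ q s t • gradPrimal f A b c p t (x t) (l t)) t := by
  have ht0 : 0 < t := ht₀.trans ht
  have h1 := (hasDerivAt_rpow_mul (q := q) (m' := derivWithin m (Ici t₀)) ht0
    (hasDerivAt_of_differentiableOn_Ici hm.diff ht)).smul
    (hasDerivAt_of_differentiableOn_Ici hsol.diff_x' ht)
  have h2 := ((hasDerivAt_rpow ht0 q).const_mul γ).smul
    (hasDerivAt_of_differentiableOn_Ici hsol.diff_grad ht)
  refine (h1.add h2).congr_deriv ?_
  -- Multiplying by t ^ q makes the damping coefficient the constant α; the second derivative of x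
  -- and the derivative of the gradient then drop out.
  have h3 := congrArg (fun v => t ^ q • v) (hsol.primal t ht.le)
  have hQ : t ^ q ≠ 0 := (Real.rpow_pos_of_pos ht0 q).ne'
  simp only [smul_add, smul_smul, smul_zero, mul_div_cancel₀ _ hQ] at h3
  rw [← Real.rpow_add ht0] at h3
  have h4 := eq_neg_of_add_eq_zero_left h3
  rw [dualStep, ← sub_eq_zero, ← h3]
  module

theorem hasDerivAt_dual (hsol : IsGlobalSolution f A b α γ c p q s t₀ m x l) (hα : 1 < α)
    (ht₀ : 0 < t₀) {t : ℝ} (ht : t₀ < t) (hδ : dualStep γ q s t ≠ 0) :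
    HasDerivAt l (((α - 1) * dualStep γ q s t) • (A (x t) - b - (c / t ^ p) • l t)
      + gapWeight γ q s t (m t) (derivWithin m (Ici t₀) t) • A (derivWithin x (Ici t₀) t)) t := by
  refine (hasDerivAt_of_differentiableOn_Ici hsol.diff_l ht).congr_deriv ?_
  rw [sub_eq_zero.1 (hsol.dual t ht.le), gradDual_eq, ← mul_extrapolation hα (ht₀.trans ht) hδ,
    map_add, map_smul]
  change ((α - 1) * dualStep γ q s t) • _ = _
  module

end IsGlobalSolution

theorem IsKKTPair.norm_sub_le_div_mul (hconv : ConvexOn ℝ univ f) (hd : Differentiable ℝ f)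
    (hc : 0 < c) (hp0 : 0 < p) (hp1 : p ≤ 1) {t τ W : ℝ} (ht : 0 < t) (htτ : t ≤ τ)
    {z w : WithLp 2 (X × Y)} (hz : IsKKTPair f A b (c / τ ^ p) z.fst z.snd)
    (hw : IsKKTPair f A b (c / t ^ p) w.fst w.snd) (hW : ‖w‖ ≤ W) :
    ‖z - w‖ ≤ W / t * (τ - t) := by
  have hτ : 0 < τ := ht.trans_le htτ
  have htp := Real.rpow_pos_of_pos ht p
  have hτp := Real.rpow_pos_of_pos hτ p
  have h1 : c / τ ^ p ≤ c / t ^ p := by gcongr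
  have h2 := hz.norm_sub_le hconv hd (by positivity) h1 hw
  have h3 : c / t ^ p / (c / τ ^ p) - 1 ≤ (τ - t) / t := by
    -- Bernoulli's inequality for exponent p ≤ 1 bounds the ratio of parameters (τ / t) ^ p by a
    -- linear function of τ - t.
    have h4 := rpow_one_add_le_one_add_mul_self (s := (τ - t) / t)
      (by have : 0 ≤ (τ - t) / t := div_nonneg (by linarith) ht.le
          linarith) hp0.le hp1
    have h5 : 1 + (τ - t) / t = τ / t := by field_simp; ring
    rw [h5, Real.div_rpow hτ.le ht.le] at h4
    have h6 : c / t ^ p / (c / τ ^ p) = τ ^ p / t ^ p := by field_simp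
    have h7 : p * ((τ - t) / t) ≤ 1 * ((τ - t) / t) := by
      have : 0 ≤ (τ - t) / t := div_nonneg (by linarith) ht.le
      gcongr
    rw [h6]
    linarith
  have h8 : 0 ≤ (τ - t) / t := div_nonneg (by linarith) ht.le
  calc ‖z - w‖ ≤ _ := h2
    _ ≤ (τ - t) / t * ‖w‖ := by gcongr
    _ ≤ (τ - t) / t * W := by gcongr
    _ = _ := by ring

theorem continuousOn_of_norm_sub_le {E : Type*} [NormedAddCommGroup E] {z : ℝ → E} {T W : ℝ}
    (hW : 0 ≤ W) (hT : 0 < T)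
    (h : ∀ t, T ≤ t → ∀ τ, t ≤ τ → ‖z τ - z t‖ ≤ W / t * (τ - t)) : ContinuousOn z (Ici T) := by
  have key : ∀ t, T ≤ t → ∀ τ, t ≤ τ → dist (z τ) (z t) ≤ W / T * dist τ t := by
    intro t ht τ hτ
    rw [dist_eq_norm, Real.dist_eq, abs_of_nonneg (sub_nonneg.2 hτ)]
    refine (h t ht τ hτ).trans ?_
    have := sub_nonneg.2 hτ
    gcongr
  have : LipschitzOnWith (W / T).toNNReal z (Ici T) := by
    refine LipschitzOnWith.of_dist_le_mul fun t ht τ hτ => ?_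
    rw [Real.coe_toNNReal _ (by positivity)]
    rcases le_total t τ with hle | hle
    · rw [dist_comm, dist_comm t]
      exact key t ht τ hle
    · exact key τ hτ t hle
  exact this.continuousOn

/-- The trajectory approaches the regularized saddle points at a rate governed by the mass. -/
theorem IsGlobalSolution.exists_norm_sq_le (hsol : IsGlobalSolution f A b α γ c p q s t₀ m x l)
    (hf : ContDiff ℝ 1 f) (hconv : ConvexOn ℝ univ f) (hα : 1 < α) (hγ : 0 < γ) (hc : 0 < c)
    (hs : 0 < s) (hq0 : 0 < q) (hq1 : q < 1) (ht₀ : 0 < t₀) (hm : IsMass t₀ m)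
    (hm1 : MassBounds γ q s m) (hm2 : MassDerivBounds t₀ m) (hp0 : 0 < p) (hp1 : p ≤ 1)
    {r σ W : ℝ} (hr0 : 0 ≤ r) (hr1 : r < 1) (hrp : p - q - s ≤ r) (hrσ : r - 2 ≤ q + σ)
    (hσ1 : q + p - 2 ≤ σ) (hσ2 : -p - 1 ≤ σ) {zt : ℝ → WithLp 2 (X × Y)}
    (hzt : ∀ t ∈ Ici t₀, IsKKTPair f A b (c / t ^ p) (zt t).fst (zt t).snd)
    (hW : ∀ t ∈ Ici t₀, ‖zt t‖ ≤ W) :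
    ∃ N, 0 < N ∧ ∀ᶠ t in atTop,
      ‖WithLp.toLp 2 (x t, l t) - zt t‖ ^ 2 ≤ N * (m t * t ^ (2 * q + s + σ + r)) := by
  have hd : Differentiable ℝ f := hf.differentiable one_ne_zero
  have hW0 : 0 ≤ W := (norm_nonneg _).trans (hW t₀ self_mem_Ici)
  obtain ⟨k₁, hk₁, hm1⟩ := hm1
  obtain ⟨k₂, hk₂, hm2⟩ := hm2
  set a := α - 1 with ha
  have ha0 : 0 < a := sub_pos.2 hα
  -- Every constraint bounds a fixed multiple of K by a positive constant, so all small positive K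
  -- qualify.
  obtain ⟨K, hK1, hK2, hK3, hK4, hK5, hK⟩ : ∃ K : ℝ, K * (5 / 2 * k₁) ≤ a / 4 ∧
      K * (1 / c * (3 * a ^ 2 + 3 * a / 2)) ≤ a / 8 ∧ K * (3 * k₁) ≤ 1 / 2 ∧
      K * (3 * γ) ≤ 1 / 2 ∧ K * (1 / c) ≤ a / 2 ∧ 0 < K :=
    ((eventually_mul_le_nhdsGT (by positivity) _).and <|
      (eventually_mul_le_nhdsGT (by positivity) _).and <|
      (eventually_mul_le_nhdsGT (by positivity) _).and <|
      (eventually_mul_le_nhdsGT (by positivity) _).and <|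
      (eventually_mul_le_nhdsGT (by positivity) _).and self_mem_nhdsWithin).exists
  set m' := derivWithin m (Ici t₀) with hm'
  set m'' := derivWithin m' (Ici t₀) with hm''
  set y := momentum f A b γ c p q t₀ m x l with hy
  set ρ := 2 * q + s + σ + r with hρ
  obtain ⟨T, hT⟩ : ∃ T, ∀ t ≥ T, t₀ < t ∧ 1 ≤ t ∧ MassBoundsAt γ q s k₁ k₂ t (m t) (m' t) (m'' t) ∧
      HasDerivAt m' (m'' t) t ∧ 2 * γ * q / t ≤ 1 ∧ (q + k₂) * k₁ / t ≤ 1 / 2 ∧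
      (1 + 3 * k₂) * k₁ / t ≤ c / 8 ∧
      ((q + k₂) * k₁ + k₁ * (q + s + γ) + 2 * γ + γ * ((1 + 3 * k₂) * k₁)) / t ≤ a / 4 ∧
      (k₂ + |ρ|) / t ≤ K / 2 * t ^ (-r) := by
    rw [← eventually_atTop]
    filter_upwards [hm1, hm2, eventually_gt_atTop t₀, eventually_ge_atTop 1,
      eventually_div_le_atTop one_pos (2 * γ * q),
      eventually_div_le_atTop one_half_pos ((q + k₂) * k₁),
      eventually_div_le_atTop (by positivity : 0 < c / 8) ((1 + 3 * k₂) * k₁),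
      eventually_div_le_atTop (by positivity : 0 < a / 4)
        ((q + k₂) * k₁ + k₁ * (q + s + γ) + 2 * γ + γ * ((1 + 3 * k₂) * k₁)),
      eventually_div_le_rpow_neg (half_pos hK) hr1 (k₂ + |ρ|)]
      with t i1 i2 i3 i4 i5 i6 i7 i8 i9
    exact ⟨i3, i4, ⟨hm.pos t i3.le, i1.1, i1.2, i2.2.1, i2.2.2⟩,
      i2.1.hasDerivWithinAt.hasDerivAt (Ici_mem_nhds i3), i5, i6, i7, i8, i9⟩
  have hgt : ∀ t ∈ Ici T, t₀ < t := fun t ht => (hT t ht).1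
  have hone : ∀ t ∈ Ici T, 1 ≤ t := fun t ht => (hT t ht).2.1
  have hpos : ∀ t ∈ Ici T, 0 < t := fun t ht => one_pos.trans_le (hone t ht)
  have hmass : ∀ t ∈ Ici T, MassBoundsAt γ q s k₁ k₂ t (m t) (m' t) (m'' t) :=
    fun t ht => (hT t ht).2.2.1
  have hmd : ∀ t ∈ Ici T, HasDerivAt m (m' t) t := fun t ht =>
    hasDerivAt_of_differentiableOn_Ici hm.diff (hgt t ht)
  have hmd' : ∀ t ∈ Ici T, HasDerivAt m' (m'' t) t := fun t ht => (hT t ht).2.2.2.1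
  have hδ : ∀ t ∈ Ici T, t ^ (q + s) / 2 ≤ dualStep γ q s t := fun t ht =>
    half_rpow_le_dualStep hγ hq0 hs (hone t ht) (by
      have := (hT t ht).2.2.2.2.1
      rwa [div_le_one (hpos t ht)] at this)
  have hTpos : ∀ t ∈ Ici T, 0 < t ^ (q + s) := fun t ht => Real.rpow_pos_of_pos (hpos t ht) _
  have hδ0 : ∀ t ∈ Ici T, 0 < dualStep γ q s t := fun t ht =>
    (half_pos (hTpos t ht)).trans_le (hδ t ht)
  let ε : ℝ → ℝ := fun t => c / t ^ p
  let μ : ℝ → ℝ := fun t => massRate q t (m t) (m' t)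
  let Θ : ℝ → ℝ := fun t => gapWeight γ q s t (m t) (m' t)
  have hμ : ∀ t ∈ Ici T, |μ t| ≤ 1 / 2 := fun t ht =>
    ((hmass t ht).abs_massRate_le hq0 hk₂ (hone t ht)).trans (hT t ht).2.2.2.2.2.1
  have hΘ0 : ∀ t ∈ Ici T, 0 ≤ Θ t := fun t ht =>
    (hmass t ht).gapWeight_nonneg hγ (hone t ht) (hδ0 t ht).le (hμ t ht)
  have hε0 : ∀ t ∈ Ici T, 0 < ε t := fun t ht =>
    div_pos hc (Real.rpow_pos_of_pos (hpos t ht) p)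
  have hzt' : ∀ t ∈ Ici T, IsKKTPair f A b (ε t) (zt t).fst (zt t).snd := fun t ht =>
    hzt t (hgt t ht).le
  have hW' : ∀ t ∈ Ici T, ‖zt t‖ ≤ W := fun t ht => hW t (hgt t ht).le
  have hlip : ∀ t, T ≤ t → ∀ τ, t ≤ τ → ‖zt τ - zt t‖ ≤ W / t * (τ - t) := fun t ht τ hτ =>
    (hzt' τ (ht.trans hτ)).norm_sub_le_div_mul hconv hd hc hp0 hp1 (hpos t ht) hτ (hzt' t ht)
      (hW' t ht)
  have dε : ∀ t ∈ Ici T, HasDerivAt ε (-(p * (c / t ^ p) / t)) t := fun t ht =>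
    hasDerivAt_const_div_rpow (hpos t ht) c p
  have dμ : ∀ t ∈ Ici T, HasDerivAt μ (massRateDeriv q t (m t) (m' t) (m'' t)) t := fun t ht =>
    hasDerivAt_massRate (hpos t ht) (hmd t ht) (hmd' t ht)
  have dΘ : ∀ t ∈ Ici T, HasDerivAt Θ (gapWeightDeriv γ q s t (m t) (m' t) (m'' t)) t :=
    fun t ht => hasDerivAt_gapWeight (hpos t ht) (hmd t ht) (hmd' t ht)
  have dx : ∀ t ∈ Ici T, HasDerivAt x (derivWithin x (Ici t₀) t) t := fun t ht =>
    hasDerivAt_of_differentiableOn_Ici hsol.diff_x (hgt t ht)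
  have dy := fun t (ht : t ∈ Ici T) => hsol.hasDerivAt_momentum hm ht₀ (hgt t ht)
  have dl := fun t (ht : t ∈ Ici T) =>
    hsol.hasDerivAt_dual hα ht₀ (hgt t ht) (hδ0 t ht).ne'
  let E : ℝ → ℝ := fun τ =>
    energy f A b a (ε τ) (Θ τ) (μ τ) (x τ) (y τ) (l τ) (zt τ).fst (zt τ).snd
  have hEcont : ContinuousOn E (Ici T) :=
    continuousOn_energy hf.continuous
      (fun t ht => (dε t ht).continuousAt.continuousWithinAt)
      (fun t ht => (dΘ t ht).continuousAt.continuousWithinAt)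
      (fun t ht => (dμ t ht).continuousAt.continuousWithinAt)
      (fun t ht => (dx t ht).continuousAt.continuousWithinAt)
      (fun t ht => (dy t ht).continuousAt.continuousWithinAt)
      (fun t ht => (dl t ht).continuousAt.continuousWithinAt)
      (continuousOn_of_norm_sub_le hW0 (hpos T self_mem_Ici) hlip)
  set B₁ := 4 * ‖A‖ ^ 2 / a with hB₁
  set B₂ := (a ^ 2 / 2 + 3 * a / 4 + 1 / 2) / K with hB₂
  set C := W ^ 2 / 2 * (5 / 2 * p * c) + B₁ * (25 / 4 * k₁ * W ^ 2 / c) + B₂ * (W ^ 2 / γ) with hC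
  let h : ℝ → ℝ := fun t => m t * t ^ ρ
  have hslope : ∀ t ∈ Ici T, ∀ R, -(K * t ^ (-r)) * E t + C * (t ^ (-r) * h t) < R →
      ∃ᶠ z in 𝓝[>] t, slope E t z < R := by
    intro t ht R hR
    have hsub : ∀ τ, t ≤ τ → τ ∈ Ici T := fun τ hτ => le_trans ht hτ
    have ht1 := hone t ht
    have ht0 := hpos t ht
    have hTt := hTpos t ht
    have hMB := hmass t ht
    have hQ : 0 < t ^ q := Real.rpow_pos_of_pos ht0 q
    have hΘle := hMB.gapWeight_le hγ hq0 ht1 (hμ t ht)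
    have hF := hasDerivAt_energy (a := a) (xb := (zt t).fst) (lb := (zt t).snd) hd (dε t ht)
      (dΘ t ht) (dμ t ht) (dx t ht) (dy t ht) (dl t ht) (gradPrimal_eq hd c p t (x t) (l t))
      rfl rfl (hzt' t ht).dual
    -- Since r ≥ p - q - s, the product is at least c * t ^ (-r); this gives κ ≤ C₁ T e with C₁ = 1
    -- / c.
    have hTe : t ^ (q + s) * ε t = c * t ^ (q + s - p) := by
      rw [Real.rpow_sub ht0]
      simp only [ε]
      ring
    refine (eventually_slope_energy_lt (R := W / t) (W := W) ha0.le hF (dε t ht).continuousAt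
      (dΘ t ht).continuousAt (dμ t ht).continuousAt (dx t ht).continuousAt (dy t ht).continuousAt
      (dl t ht).continuousAt (fun τ hτ => (hε0 τ (hsub τ hτ)).le) (fun τ hτ => hΘ0 τ (hsub τ hτ))
      (fun τ hτ => by linarith [(abs_le.1 (hμ τ (hsub τ hτ))).2])
      (fun τ hτ => (isSaddlePt_tikhonovLagrangian_iff hconv hd (hε0 τ (hsub τ hτ)).le).2
        (hzt' τ (hsub τ hτ)))
      (hlip t ht) (fun τ hτ => hW' τ (hsub τ hτ)) (lt_of_le_of_lt ?_ hR)).frequently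
    refine (energy_rate_le (T := t ^ (q + s)) (κ := t ^ (-r)) (K := K) (k₁ := k₁) (C₁ := 1 / c)
      (C₂ := γ) (C₃ := 5 / 2 * k₁) (W := W) hconv hd ha0 hTt (hε0 t ht)
      (Real.rpow_pos_of_pos ht0 _) (Real.rpow_le_one_of_one_le_of_nonpos ht1 (by linarith)) ?_
      (hδ t ht) (mul_nonneg hQ.le hMB.pos.le) (hMB.rpow_mul_le ht1) (mul_nonneg hγ.le hQ.le) ?_
      (hΘ0 t ht) ?_ ?_ (hμ t ht) ?_ ?_ (by positivity) hK hK1 (by linarith) (by linarith)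
      (by linarith) hK5 (hzt' t ht) (hW' t ht) rfl).trans ?_
    · rw [hTe, ← mul_assoc, one_div_mul_cancel hc.ne', one_mul]
      exact Real.rpow_le_rpow_of_exponent_le ht1 (by linarith)
    · have : t ^ q ≤ t ^ (q + s) := Real.rpow_le_rpow_of_exponent_le ht1 (by linarith)
      gcongr
    · refine hΘle.trans ?_
      linarith [mul_le_mul_of_nonneg_right (hMB.rpow_mul_le ht1) hTt.le]
    · refine (hMB.gapWeightDeriv_le hγ hq0 hq1 hs hk₂ ht1 (hδ0 t ht).le (hμ t ht)).trans ?_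
      have := mul_le_mul_of_nonneg_right (hT t ht).2.2.2.2.2.2.2.1 hTt.le
      calc _ = _ := by rw [mul_div_assoc', div_mul_eq_mul_div]
        _ ≤ _ := this
        _ = _ := by ring
    · refine (hMB.abs_massRateDeriv_le hq0 hq1 hk₂ ht1).trans ?_
      rw [hTe]
      have h1 := (hT t ht).2.2.2.2.2.2.1
      have h2 : t⁻¹ ≤ t ^ (q + s - p) := by
        rw [← Real.rpow_neg_one]
        exact Real.rpow_le_rpow_of_exponent_le ht1 (by linarith)
      calc (1 + 3 * k₂) * k₁ / t ^ 2 = (1 + 3 * k₂) * k₁ / t * t⁻¹ := by field_simp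
        _ ≤ c / 8 * t ^ (q + s - p) := by gcongr
        _ = _ := by ring
    · have := hε0 t ht
      exact neg_nonpos.2 (by positivity)
    · have := hMB.source_le (W := W) (B₁ := B₁) (B₂ := B₂) hγ ht1 hc hp0 hσ1 hσ2 hq0 hrσ
        (by positivity) (by positivity) (hΘ0 t ht) hΘle
      exact add_le_add le_rfl this
  have hh : ∀ t ∈ Ici T, 0 < h t := fun t ht =>
    mul_pos (hmass t ht).pos (Real.rpow_pos_of_pos (hpos t ht) _)
  obtain ⟨N, hN, hEN⟩ := exists_le_mul_of_slope_lt (κ := fun t => t ^ (-r)) (C := C) hK hEcont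
    hslope (fun t ht => le_rfl) (fun t ht => Real.rpow_pos_of_pos (hpos t ht) _) hh
    (fun t ht => (hmd t ht).mul (hasDerivAt_rpow (hpos t ht) ρ)) (fun t ht => by
      refine (neg_mul_rpow_deriv_le (hpos t ht) (hmass t ht).pos (hmass t ht).deriv).trans ?_
      have := mul_le_mul_of_nonneg_right (hT t ht).2.2.2.2.2.2.2.2 (hh t ht).le
      rwa [mul_assoc] at this)
  refine ⟨(4 / a + 2) * N, by positivity, ?_⟩
  filter_upwards [eventually_ge_atTop T] with t ht
  calc _ ≤ (4 / a + 2) * E t :=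
        norm_sq_le_energy hconv hd ha0 (hε0 t ht).le (hΘ0 t ht) (hμ t ht) (hzt' t ht)
    _ ≤ (4 / a + 2) * (N * h t) := by gcongr; exact hEN t ht
    _ = _ := by ring

end System

/-! ### Objective and feasibility rates from the distance rate. -/

section Rates

variable {X Y : Type*} [NormedAddCommGroup X] [InnerProductSpace ℝ X] [CompleteSpace X]
  [NormedAddCommGroup Y] [InnerProductSpace ℝ Y] [CompleteSpace Y]
  {f : X → ℝ} {A : X →L[ℝ] Y} {b : Y}

/-- The objective value of a regularized saddle point is close to the optimal value. -/
theorem IsKKTPair.abs_sub_le (hconv : ConvexOn ℝ univ f) (hd : Differentiable ℝ f)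
    {e : ℝ} (he : 0 ≤ e) {z w : WithLp 2 (X × Y)} (hz : IsKKTPair f A b e z.fst z.snd)
    (hw : IsKKTPair f A b 0 w.fst w.snd) (hzw : ‖z‖ ≤ ‖w‖) :
    |f z.fst - f w.fst| ≤ e * ‖w‖ ^ 2 := by
  have hAw : A w.fst - b = 0 := by rw [hw.dual, zero_smul]
  have hA : A (w.fst - z.fst) = -(e • z.snd) := by
    rw [← hz.dual, map_sub, sub_eq_zero.1 hAw]
    abel
  have hA' : A (z.fst - w.fst) = e • z.snd := by rw [← neg_sub, map_neg, hA, neg_neg]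
  have n1 : ‖z.fst‖ ≤ ‖w‖ := (WithLp.norm_fst_le ..).trans hzw
  have n2 : ‖z.snd‖ ≤ ‖w‖ := (WithLp.norm_snd_le ..).trans hzw
  have n3 : ‖w.fst‖ ≤ ‖w‖ := WithLp.norm_fst_le ..
  have n4 : ‖w.snd‖ ≤ ‖w‖ := WithLp.norm_snd_le ..
  have h1 := hconv.add_inner_gradient_le (hd z.fst) w.fst
  have h2 := hconv.add_inner_gradient_le (hd w.fst) z.fst
  have g1 : gradient f z.fst = -(A.adjoint z.snd + e • z.fst) := by
    rw [eq_neg_iff_add_eq_zero, ← add_assoc, hz.primal]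
  have g2 : gradient f w.fst = -A.adjoint w.snd := by
    have := hw.primal
    rwa [zero_smul, add_zero, ← eq_neg_iff_add_eq_zero] at this
  rw [g1, inner_neg_left, inner_add_left, ContinuousLinearMap.adjoint_inner_left, hA,
    inner_neg_right, real_inner_smul_right, real_inner_smul_left, real_inner_self_eq_norm_sq,
    inner_sub_right, real_inner_self_eq_norm_sq] at h1
  rw [g2, inner_neg_left, ContinuousLinearMap.adjoint_inner_left, hA', real_inner_smul_right] at h2
  have i1 : e * inner ℝ z.fst w.fst ≤ e * ‖w‖ ^ 2 := by
    have : inner ℝ z.fst w.fst ≤ ‖w‖ * ‖w‖ := (real_inner_le_norm _ _).trans (by gcongr)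
    rw [sq]
    gcongr
  have i2 : e * inner ℝ w.snd z.snd ≤ e * ‖w‖ ^ 2 := by
    have : inner ℝ w.snd z.snd ≤ ‖w‖ * ‖w‖ := (real_inner_le_norm _ _).trans (by gcongr)
    rw [sq]
    gcongr
  have i3 : 0 ≤ e * ‖z.snd‖ ^ 2 := by positivity
  have i4 : 0 ≤ e * ‖z.fst‖ ^ 2 := by positivity
  rw [abs_le]
  constructor <;> linarith

/-- Rates for the objective and the feasibility gap from a rate for the distance to the regularized
saddle points. -/
theorem isBigO_rates (hf : ContDiff ℝ 1 f) (hconv : ConvexOn ℝ univ f) {c p ω N t₀ : ℝ}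
    {m : ℝ → ℝ} {z zt : ℝ → WithLp 2 (X × Y)} {zs : WithLp 2 (X × Y)} (hc : 0 < c)
    (hzs : IsKKTPair f A b 0 zs.fst zs.snd)
    (hzt : ∀ t ∈ Ici t₀, IsKKTPair f A b (c / t ^ p) (zt t).fst (zt t).snd)
    (hle : ∀ t ∈ Ici t₀, ‖zt t‖ ≤ ‖zs‖) (hm : ∀ t ∈ Ici t₀, 0 < m t)
    (hlimt : Tendsto zt atTop (𝓝 zs)) (hlim : Tendsto z atTop (𝓝 zs))
    (hN : ∀ᶠ t in atTop, ‖z t - zt t‖ ^ 2 ≤ N * (m t * t ^ ω)) :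
    ((fun t => lagrangian f A b (z t).fst zs.snd - lagrangian f A b zs.fst zs.snd) =O[atTop]
        fun t => √(m t) * t ^ (ω / 2) + 1 / t ^ p) ∧
      ((fun t => |f (z t).fst - f zs.fst|) =O[atTop]
        fun t => √(m t) * t ^ (ω / 2) + 1 / t ^ p) ∧
      ((fun t => ‖A (z t).fst - b‖) =O[atTop]
        fun t => √(m t) * t ^ (ω / 2) + 1 / t ^ p) ∧
      ((fun t => ‖z t - zt t‖ ^ 2) =O[atTop] fun t => m t * t ^ ω) := by
  have hd : Differentiable ℝ f := hf.differentiable one_ne_zero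
  have hcont : Continuous (fun w : WithLp 2 (X × Y) => w.fst) :=
    (WithLp.prod_continuous_ofLp 2 X Y).fst
  have hAs : A zs.fst - b = 0 := by rw [hzs.dual, zero_smul]
  have hev : ∀ᶠ t : ℝ in atTop, t ∈ Ici t₀ := eventually_ge_atTop t₀
  have hp : ∀ᶠ t : ℝ in atTop, 0 < t := eventually_gt_atTop 0
  have O1 : (fun t => (z t).fst - (zt t).fst) =O[atTop]
      fun t => √(m t) * t ^ (ω / 2) + 1 / t ^ p := by
    refine IsBigO.of_bound √N ?_
    filter_upwards [hev, hp, hN] with t h1 h2 h3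
    have h4 : √(m t * t ^ ω) = √(m t) * t ^ (ω / 2) := by
      rw [Real.sqrt_mul (hm t h1).le, Real.sqrt_eq_rpow (t ^ ω), ← Real.rpow_mul h2.le]
      ring_nf
    have h5 : 0 < t ^ (ω / 2) := Real.rpow_pos_of_pos h2 _
    have h6 : 0 < t ^ p := Real.rpow_pos_of_pos h2 _
    have h8 : 0 < t ^ ω := Real.rpow_pos_of_pos h2 _
    have h9 := hm t h1
    rw [Real.norm_of_nonneg (by positivity)]
    calc ‖(z t).fst - (zt t).fst‖ ≤ ‖z t - zt t‖ := WithLp.norm_fst_le _ (z t - zt t)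
      _ ≤ √(N * (m t * t ^ ω)) := Real.le_sqrt_of_sq_le h3
      _ = √N * (√(m t) * t ^ (ω / 2)) := by
        rw [Real.sqrt_mul' _ (by positivity), h4]
      _ ≤ √N * (√(m t) * t ^ (ω / 2) + 1 / t ^ p) := by
        gcongr
        exact le_add_of_nonneg_right (by positivity)
  have O2 : (fun t : ℝ => c / t ^ p) =O[atTop]
      fun t => √(m t) * t ^ (ω / 2) + 1 / t ^ p := by
    refine IsBigO.of_bound c ?_
    filter_upwards [hp] with t h2
    have h5 : 0 < t ^ (ω / 2) := Real.rpow_pos_of_pos h2 _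
    have h6 : 0 < t ^ p := Real.rpow_pos_of_pos h2 _
    rw [Real.norm_of_nonneg (by positivity), Real.norm_of_nonneg (by positivity), mul_add,
      mul_one_div]
    exact le_add_of_nonneg_left (by positivity)
  have O3 : (fun t => A (z t).fst - b) =O[atTop]
      fun t => √(m t) * t ^ (ω / 2) + 1 / t ^ p := by
    have h1 : (fun t => A (zt t).fst - b) =O[atTop] fun t : ℝ => c / t ^ p := by
      refine IsBigO.of_bound ‖zs‖ ?_
      filter_upwards [hev] with t h1
      rw [(hzt t h1).dual, norm_smul, mul_comm]
      gcongr
      exact (WithLp.norm_snd_le ..).trans (hle t h1)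
    refine (((A.isBigO_comp _ atTop).trans O1).add (h1.trans O2)).congr_left fun t => ?_
    rw [map_sub]
    abel
  have O4 : (fun t => f (z t).fst - f zs.fst) =O[atTop]
      fun t => √(m t) * t ^ (ω / 2) + 1 / t ^ p := by
    -- Both curves converge to the same point, so a Lipschitz constant of f near that point
    -- suffices.
    obtain ⟨k, U, hU, hk⟩ := hf.contDiffAt.exists_lipschitzOnWith (x := zs.fst)
    have h1 : (fun t => f (z t).fst - f (zt t).fst) =O[atTop]
        fun t => (z t).fst - (zt t).fst := by
      refine IsBigO.of_bound k ?_
      filter_upwards [((hcont.tendsto zs).comp hlim).eventually hU,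
        ((hcont.tendsto zs).comp hlimt).eventually hU] with t h2 h3
      simpa [dist_eq_norm] using hk.dist_le_mul _ h2 _ h3
    have h2 : (fun t => f (zt t).fst - f zs.fst) =O[atTop] fun t : ℝ => c / t ^ p := by
      refine IsBigO.of_bound (‖zs‖ ^ 2) ?_
      filter_upwards [hev, hp] with t h1 h2
      have h3 := Real.rpow_pos_of_pos h2 p
      rw [Real.norm_eq_abs, Real.norm_of_nonneg (by positivity), mul_comm]
      exact (hzt t h1).abs_sub_le hconv hd (by positivity) hzs (hle t h1)
    refine ((h1.trans O1).add (h2.trans O2)).congr_left fun t => ?_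
    ring
  refine ⟨?_, O4.norm_left, O3.norm_left, ?_⟩
  · refine (O4.add (((innerSL ℝ zs.snd).isBigO_comp _ atTop).trans O3)).congr_left fun t => ?_
    rw [lagrangian, lagrangian, hAs, inner_zero_right, innerSL_apply_apply]
    ring
  · refine IsBigO.of_bound N ?_
    filter_upwards [hev, hp, hN] with t h1 h2 h3
    have h4 := Real.rpow_pos_of_pos h2 ω
    have h5 := hm t h1
    rwa [Real.norm_of_nonneg (by positivity), Real.norm_of_nonneg (by positivity)]

end Rates

/-! ### Strong convergence and the main theorem. -/

theorem tendsto_norm_sub_of_sq_le {E : Type*} [NormedAddCommGroup E] {z w : ℝ → E} {m : ℝ → ℝ}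
    {k q ω N : ℝ} (hm : ∀ᶠ t : ℝ in atTop, m t ≤ k / t ^ q) (hω : ω < q) (hN : 0 ≤ N)
    (h : ∀ᶠ t in atTop, ‖z t - w t‖ ^ 2 ≤ N * (m t * t ^ ω)) :
    Tendsto (fun t => z t - w t) atTop (𝓝 0) := by
  have h1 : Tendsto (fun t : ℝ => N * (k * t ^ (-(q - ω)))) atTop (𝓝 0) := by
    simpa using ((tendsto_rpow_neg_atTop (sub_pos.2 hω)).const_mul k).const_mul N
  have h2 : Tendsto (fun t => ‖z t - w t‖ ^ 2) atTop (𝓝 0) := by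
    refine squeeze_zero' (Eventually.of_forall fun t => sq_nonneg _) ?_ h1
    filter_upwards [hm, h, eventually_gt_atTop 0] with t h2 h3 ht
    have h4 := Real.rpow_pos_of_pos ht ω
    have h5 : k * t ^ (-(q - ω)) = k / t ^ q * t ^ ω := by
      rw [neg_sub, Real.rpow_sub ht]
      ring
    rw [h5]
    refine h3.trans ?_
    gcongr
  rw [tendsto_zero_iff_norm_tendsto_zero]
  simpa using h2.sqrt

theorem mainTheorem1
    {X Y : Type*} [NormedAddCommGroup X] [InnerProductSpace ℝ X] [CompleteSpace X]
    [NormedAddCommGroup Y] [InnerProductSpace ℝ Y] [CompleteSpace Y]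
    (f : X → ℝ) (hf : ContDiff ℝ 1 f) (hconv : ConvexOn ℝ univ f)
    (A : X →L[ℝ] Y) (b : Y) (hΩ : (primalDualSolutions f A b).Nonempty)
    (α γ c p q s t₀ : ℝ) (hα : 1 < α) (hγ : 0 < γ) (hc : 0 < c) (hs : 0 < s)
    (hq0 : 0 < q) (hq1 : q < 1) (ht₀ : 0 < t₀)
    (m : ℝ → ℝ) (hm : IsMass t₀ m) (hm1 : MassBounds γ q s m) (hm2 : MassDerivBounds t₀ m)
    (hp0 : 0 < p) (hp1 : p < 1 - q)
    (h1 : 4 * q + s + p - 2 < 0) (h2 : 3 * q + s - p - 1 < 0)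
    (x : ℝ → X) (l : ℝ → Y) (hsol : IsGlobalSolution f A b α γ c p q s t₀ m x l)
    (r : ℝ) (hr : r = max q (p - q - s)) :
    -- the projection of `0` onto the solution set and the regularized saddle points are well defined
    (∃! z, IsProjOnto (primalDualSolutions f A b) 0 z) ∧
    (∀ t ∈ Ici t₀, ∃! z, IsSaddlePt (regLagrangian f A b c p t) z) ∧
    ∀ zs : WithLp 2 (X × Y), IsProjOnto (primalDualSolutions f A b) 0 zs →
    ∀ zt : ℝ → WithLp 2 (X × Y),
      (∀ t ∈ Ici t₀, IsSaddlePt (regLagrangian f A b c p t) (zt t)) →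
      Tendsto (fun t => ‖WithLp.toLp 2 (x t, l t) - zs‖) atTop (𝓝 0) ∧
      ((1 - q) / 2 ≤ p →
        ((fun t => lagrangian f A b (x t) zs.snd - lagrangian f A b zs.fst zs.snd) =O[atTop]
          fun t => √(m t) * t ^ ((3 * q + s + p - 2 + r) / 2) + 1 / t ^ p) ∧
        ((fun t => |f (x t) - f zs.fst|) =O[atTop]
          fun t => √(m t) * t ^ ((3 * q + s + p - 2 + r) / 2) + 1 / t ^ p) ∧
        ((fun t => ‖A (x t) - b‖) =O[atTop]
          fun t => √(m t) * t ^ ((3 * q + s + p - 2 + r) / 2) + 1 / t ^ p) ∧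
        ((fun t => ‖WithLp.toLp 2 (x t, l t) - zt t‖ ^ 2) =O[atTop]
          fun t => m t * t ^ (3 * q + s + p - 2 + r))) ∧
      (p < (1 - q) / 2 →
        ((fun t => lagrangian f A b (x t) zs.snd - lagrangian f A b zs.fst zs.snd) =O[atTop]
          fun t => √(m t) * t ^ ((2 * q + s - p - 1 + r) / 2) + 1 / t ^ p) ∧
        ((fun t => |f (x t) - f zs.fst|) =O[atTop]
          fun t => √(m t) * t ^ ((2 * q + s - p - 1 + r) / 2) + 1 / t ^ p) ∧
        ((fun t => ‖A (x t) - b‖) =O[atTop]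
          fun t => √(m t) * t ^ ((2 * q + s - p - 1 + r) / 2) + 1 / t ^ p) ∧
        ((fun t => ‖WithLp.toLp 2 (x t, l t) - zt t‖ ^ 2) =O[atTop]
          fun t => m t * t ^ (2 * q + s - p - 1 + r))) := by
  have hd : Differentiable ℝ f := hf.differentiable one_ne_zero
  have hε : ∀ t ∈ Ici t₀, 0 < c / t ^ p := fun t ht =>
    div_pos hc (Real.rpow_pos_of_pos (ht₀.trans_le ht) p)
  have hiff : ∀ t ∈ Ici t₀, ∀ z : WithLp 2 (X × Y),
      IsSaddlePt (regLagrangian f A b c p t) z ↔ IsKKTPair f A b (c / t ^ p) z.fst z.snd :=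
    fun t ht z => by
      rw [regLagrangian_eq]
      exact isSaddlePt_tikhonovLagrangian_iff hconv hd (hε t ht).le
  have hanti : StrictAntiOn (fun t : ℝ => c / t ^ p) (Ici t₀) := by
    intro t ht u _ htu
    have h3 : 0 < t := ht₀.trans_le ht
    have := Real.rpow_pos_of_pos h3 p
    simp only
    gcongr
  have hε0 : Tendsto (fun t : ℝ => c / t ^ p) atTop (𝓝 0) :=
    tendsto_const_nhds.div_atTop (tendsto_rpow_atTop hp0)
  have hex : ∀ t ∈ Ici t₀, ∃ z : WithLp 2 (X × Y),
      IsKKTPair f A b (c / t ^ p) z.fst z.snd := fun t ht =>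
    exists_isKKTPair hf hconv A b (hε t ht)
  refine ⟨?_, fun t ht => ?_, fun zs hzs zt hzt => ?_⟩
  · choose! w hw using hex
    obtain ⟨zs, -, hproj, -, huniq⟩ := exists_tendsto_isKKTPair hf hconv hΩ hε hanti hε0 hw
    exact ⟨zs, hproj, huniq⟩
  · obtain ⟨z, hz⟩ := hex t ht
    exact ⟨z, (hiff t ht z).2 hz, fun w hw =>
      ((hiff t ht w).1 hw).unique hconv hd (hε t ht) hz⟩
  have hkkt : ∀ t ∈ Ici t₀, IsKKTPair f A b (c / t ^ p) (zt t).fst (zt t).snd := fun t ht =>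
    (hiff t ht _).1 (hzt t ht)
  obtain ⟨zs', hlimt, -, hle, huniq⟩ := exists_tendsto_isKKTPair hf hconv hΩ hε hanti hε0 hkkt
  obtain rfl := huniq zs hzs
  have hzs0 := (mem_primalDualSolutions_iff hconv hd).1 hzs.1
  have hrq : q ≤ r := hr ▸ le_max_left _ _
  have hrp : p - q - s ≤ r := hr ▸ le_max_right _ _
  have hrmax : ∀ k, q ≤ k → p - q - s ≤ k → r ≤ k := fun k hk hk' => hr ▸ max_le hk hk'
  have hr1 : r < 1 := hr ▸ max_lt hq1 (by linarith)
  have hbound : ∃ k, ∀ᶠ t : ℝ in atTop, m t ≤ k / t ^ q := by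
    obtain ⟨k₁, -, hk₁⟩ := hm1
    exact ⟨k₁, hk₁.mono fun t ht => ht.2⟩
  -- Any admissible source exponent σ gives the distance rate m t ^ ω. The condition ω < q makes it
  -- vanish, because m = O(t ^ (-q)).
  have key : ∀ σ ω : ℝ, q + p - 2 ≤ σ → -p - 1 ≤ σ → r - 2 ≤ q + σ → ω = 2 * q + s + σ + r →
      ω < q → Tendsto (fun t => WithLp.toLp 2 (x t, l t)) atTop (𝓝 zs) ∧
      ∃ N, ∀ᶠ t in atTop, ‖WithLp.toLp 2 (x t, l t) - zt t‖ ^ 2 ≤ N * (m t * t ^ ω) := by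
    intro σ ω hσ1 hσ2 hrσ hω hωq
    obtain ⟨N, hN0, hN⟩ := hsol.exists_norm_sq_le hf hconv hα hγ hc hs hq0 hq1 ht₀ hm hm1 hm2 hp0
      (by linarith) (by linarith) hr1 hrp hrσ hσ1 hσ2 hkkt hle
    rw [← hω] at hN
    obtain ⟨k, hk⟩ := hbound
    refine ⟨?_, N, hN⟩
    simpa using (tendsto_norm_sub_of_sq_le hk hωq hN0.le hN).add hlimt
  -- The lower bounds q + p - 2 and -p - 1 on σ coincide at p = (1 - q) / 2; each case takes the
  -- larger one. The hypotheses `h1` and `h2`, respectively, handle r = q in showing ω ≤ 0 < q.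
  have keyA : (1 - q) / 2 ≤ p → _ := fun hp =>
    key (q + p - 2) (3 * q + s + p - 2 + r) le_rfl (by linarith)
      (by linarith [hrmax (2 * q + p) (by linarith) (by linarith)]) (by ring)
      (by linarith [hrmax (2 - 2 * q - s - p - q) (by linarith) (by linarith)])
  have keyB : p < (1 - q) / 2 → _ := fun hp =>
    key (-p - 1) (2 * q + s - p - 1 + r) (by linarith) le_rfl
      (by linarith [hrmax (q + 1 - p) (by linarith) (by linarith)]) (by ring)
      (by linarith [hrmax (p + 1 - q - s - q) (by linarith) (by linarith)])
  refine ⟨?_, fun hp => ?_, fun hp => ?_⟩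
  · rw [← tendsto_iff_norm_sub_tendsto_zero]
    rcases le_or_gt ((1 - q) / 2) p with hp | hp
    · exact (keyA hp).1
    · exact (keyB hp).1
  · obtain ⟨hlim, N, hN⟩ := keyA hp
    exact isBigO_rates hf hconv hc hzs0 hkkt hle hm.pos hlimt hlim hN
  · obtain ⟨hlim, N, hN⟩ := keyB hp
    exact isBigO_rates hf hconv hc hzs0 hkkt hle hm.pos hlimt hlim hN
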